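/- **Theorem (polynomial-time soundness for $RS_1^-$).** If $\vdash f:\gamma_1\to\gamma_0$ is derivable in $RS_1^-$ and the type $\gamma_1$ is normal, then $f$ is DP-poly-cost: there is a polynomial $q$ such that for every variable $x_1$ and every environment $\theta$ assigning to $x_1$ a type-$\gamma_1$ value, the closure $(f\,x_1)\theta$ evaluates to a value under the dynamic-programming evaluation, and $\mathrm{cost}_{DP}((f\,x_1)\theta)\le q(\mathrm{size}(\theta(x_1)))$. Here $RS_1^-$ is the following first-order typed $\lambda$-calculus. *Types.* Polynomial functors are $P::=\mathrm{Id}\mid \mathsf C_N\mid P+P\mid P\times P$, normal base types are $N::=\mathsf{unit}\mid \mu P$ (least fixed points, called data types), and ground types are $\gamma::=N\mid \mathsf S\,\mathsf{unit}\mid\mathsf S(\mu P)\mid\gamma+\gamma\mid\gamma\times\gamma$. A ground type is *normal* (resp. *safe*) if all its base types are without (resp. with) the mark $\mathsf S$. $\mathsf S\gamma$ (resp. $\mathsf N\gamma$) is $\gamma$ with the mark $\mathsf S$ put on (resp. removed from) all its base types. Types are ground types and types $\gamma_1\to\gamma_0$ between ground types. Empty data types are excluded from typing judgments. Contexts $\Gamma$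 assign ground types to variables. *Terms and typing.* The terms are variables, $\lambda x.e$, $(e_0\,e_1)$, $()$, $(e_1,e_2)$, $\pi_j e$, $\iota_j e$ and $\mathsf{case}\ e_0\ \mathsf{of}\ (\iota_1x_1)\Rightarrow e_1;(\iota_2x_2)\Rightarrow e_2$, with the usual simple typing rules, where for $\mathsf{case}$ the scrutinee has a type $\gamma_1+\gamma_2$, both branches have a ground type $\gamma$, and it is required that $\gamma_1+\gamma_2$ is normal or $\gamma$ is safe; and, for each data type $\delta=\mu P$: constructors $\mathsf c_\delta:P(\delta)\to\delta$ and $\mathsf c_{\mathsf S\delta}:\mathsf S(P\delta)\to\mathsf S\delta$; destructors $\mathsf d_\delta:\delta\to P(\delta)$ and $\mathsf d_{\mathsf S\delta}:\mathsf S\delta\to\mathsf S(P\delta)$; recursion $\Gamma\vdash\mathsf{fold}_\delta(\lambda z.e_0)\,e_1:\mathsf S\gamma$ if $\Gamma\vdash\lambda z.e_0:P(\mathsf S\gamma)\to\mathsf S\gamma$ and $\Gamma\vdash e_1:\delta$; and the coercions $\Gamma\vdash\mathsf{toSafe}\,e:\mathsf S\gamma$ if $\Gamma\vdash e:\gamma$,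 and $\Gamma\vdash\mathsf{toNorm}\,e:\mathsf N\gamma$ if $\Gamma\vdash e:\gamma$ and $\Gamma(x)$ is normal for each free variable $x$ of $e$. *Values.* A value is a finite rooted dag, possibly with sharing, with vertices labeled $()$ (no out-edge), $\iota_1$, $\iota_2$, $\mathsf C_{\mu P}$ (one out-edge) or $(,)$ (two ordered out-edges). It is a type-$\gamma$ value if it represents a closed normal form of type $\mathsf N\gamma$. $\mathrm{size}(v)$ is the number of vertices of $v$ with a label $\mathsf C_{\mu P}$. *Evaluation and cost.* Closures $e\theta$ are evaluated call-by-value; pairs, injections and (normal or safe) constructors create a new root vertex above the existing graphs, $()$ creates a single vertex, and $\mathsf{toSafe}\,e$ and $\mathsf{toNorm}\,e$ return the value of $e$. In the dynamic-programming evaluation of $(\mathsf{fold}_{\mu P}\,f\,e)\theta$, first $e\theta$ is evaluated, and then the equation $\mathsf{fold}_{\mu P}\,f\,(\mathsf C_{\mu P}\,u)=f\,(P(\mathsf{fold}_{\mu P}\,f)\,u)$ is applied along the resulting dag; the result at each vertex is saved when it is first computed and looked up afterwards, so that $f$ is evaluated at most once for each vertex. $\mathrm{cost}_{DP}(e\theta)$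 is the number of nodes of the derivation tree of the dynamic-programming evaluation of $e\theta$, where each saved result that is looked up counts as one node. -/

import Mathlib

namespace RSMinus

/-! ### Types -/

/-- Polynomial functors over normal base types:
`P ::= Id | C_N | P + P | P × P`, where `N ::= unit | μP`. The constant functor `C_N` is given
by the two constructors `constUnit` (for `N = unit`) and `constMu Q` (for `N = μQ`). -/
inductive Poly : Type
  | id : Poly
  | constUnit : Poly
  | constMu : Poly → Poly
  | sum : Poly → Poly → Poly
  | prod : Poly → Poly → Poly

/-- Ground types: normal base types `unit` and `μP`, their safe versions, and sums and
products. -/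
inductive Ty : Type
  | unit : Ty
  | mu : Poly → Ty
  | safeUnit : Ty
  | safeMu : Poly → Ty
  | sum : Ty → Ty → Ty
  | prod : Ty → Ty → Ty

/-- All types: ground types and level-1 types `γ₁ → γ₀` between ground types. -/
inductive FTy : Type
  | ground : Ty → FTy
  | arrow : Ty → Ty → FTy

/-- The type `P(γ)`. -/
def Poly.app : Poly → Ty → Ty
  | .id, γ => γ
  | .constUnit, _ => .unit
  | .constMu Q, _ => .mu Q
  | .sum P Q, γ => .sum (P.app γ) (Q.app γ)
  | .prod P Q, γ => .prod (P.app γ) (Q.app γ)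

/-- The safe version of a ground type. -/
def Ty.safe : Ty → Ty
  | .unit => .safeUnit
  | .mu P => .safeMu P
  | .safeUnit => .safeUnit
  | .safeMu P => .safeMu P
  | .sum α β => .sum α.safe β.safe
  | .prod α β => .prod α.safe β.safe

/-- The normal version of a ground type: all safe marks are removed. -/
def Ty.norm : Ty → Ty
  | .unit => .unit
  | .mu P => .mu P
  | .safeUnit => .unit
  | .safeMu P => .mu P
  | .sum α β => .sum α.norm β.norm
  | .prod α β => .prod α.norm β.norm

/-- A ground type is normal if each constituent base type is normal. -/
def Ty.IsNormal : Ty → Prop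
  | .unit => True
  | .mu _ => True
  | .safeUnit => False
  | .safeMu _ => False
  | .sum α β => α.IsNormal ∧ β.IsNormal
  | .prod α β => α.IsNormal ∧ β.IsNormal

/-- A ground type is safe if each constituent base type is safe. -/
def Ty.IsSafe : Ty → Prop
  | .unit => False
  | .mu _ => False
  | .safeUnit => True
  | .safeMu _ => True
  | .sum α β => α.IsSafe ∧ β.IsSafe
  | .prod α β => α.IsSafe ∧ β.IsSafe

/-- `P(∅)` is nonempty, provided that all constants of `P` are nonempty. For such `P` this says
that the least fixed point `μP` is nonempty. -/
def Poly.NonemptyAtEmpty : Poly → Prop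
  | .id => False
  | .constUnit => True
  | .constMu _ => True
  | .sum P Q => P.NonemptyAtEmpty ∨ Q.NonemptyAtEmpty
  | .prod P Q => P.NonemptyAtEmpty ∧ Q.NonemptyAtEmpty

/-- All data types occurring as constants in `P`, hereditarily, are inhabited. -/
def Poly.ConstsInhabited : Poly → Prop
  | .id => True
  | .constUnit => True
  | .constMu Q => Q.ConstsInhabited ∧ Q.NonemptyAtEmpty
  | .sum P Q => P.ConstsInhabited ∧ Q.ConstsInhabited
  | .prod P Q => P.ConstsInhabited ∧ Q.ConstsInhabited

/-- No empty data type occurs in the ground type. -/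
def Ty.Inhabited : Ty → Prop
  | .unit => True
  | .mu P => P.ConstsInhabited ∧ P.NonemptyAtEmpty
  | .safeUnit => True
  | .safeMu P => P.ConstsInhabited ∧ P.NonemptyAtEmpty
  | .sum α β => α.Inhabited ∧ β.Inhabited
  | .prod α β => α.Inhabited ∧ β.Inhabited

/-! ### Expressions and typing -/

/-- Identifiers. -/
abbrev Ident : Type := ℕ

/-- Raw expressions. -/
inductive Exp : Type
  | var : Ident → Exp
  | lam : Ident → Exp → Exp
  | app : Exp → Exp → Exp
  | unit : Exp
  | pair : Exp → Exp → Exp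
  | fst : Exp → Exp
  | snd : Exp → Exp
  | inl : Exp → Exp
  | inr : Exp → Exp
  /-- `case e₀ of (ι₁ x₁) ⇒ e₁; (ι₂ x₂) ⇒ e₂` is `case e₀ x₁ e₁ x₂ e₂`. -/
  | case : Exp → Ident → Exp → Ident → Exp → Exp
  /-- The constructor of the data type `μP`. -/
  | con : Poly → Exp → Exp
  /-- The destructor of the data type `μP`. -/
  | des : Poly → Exp → Exp
  /-- `fold P e₀ e₁` is the structural recursion over `μP` with step function `e₀` on `e₁`. -/
  | fold : Poly → Exp → Exp → Exp
  /-- The constructor of the safe version of `μP`. -/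
  | safeCon : Poly → Exp → Exp
  /-- The destructor of the safe version of `μP`. -/
  | safeDes : Poly → Exp → Exp
  | toSafe : Exp → Exp
  | toNorm : Exp → Exp

/-- Free variables. -/
def Exp.fv : Exp → Finset Ident
  | .var x => {x}
  | .lam x e => e.fv.erase x
  | .app e₀ e₁ => e₀.fv ∪ e₁.fv
  | .unit => ∅
  | .pair e₁ e₂ => e₁.fv ∪ e₂.fv
  | .fst e => e.fv
  | .snd e => e.fv
  | .inl e => e.fv
  | .inr e => e.fv
  | .case e₀ x₁ e₁ x₂ e₂ => e₀.fv ∪ (e₁.fv.erase x₁ ∪ e₂.fv.erase x₂)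
  | .con _ e => e.fv
  | .des _ e => e.fv
  | .fold _ e₀ e₁ => e₀.fv ∪ e₁.fv
  | .safeCon _ e => e.fv
  | .safeDes _ e => e.fv
  | .toSafe e => e.fv
  | .toNorm e => e.fv

/-- Type contexts assign ground types to finitely many identifiers; the empty context is
`fun _ => none`, and a context is extended by `Function.update`. -/
abbrev Ctx : Type := Ident → Option Ty

/-- The typing judgment `Γ ⊢ e : τ`. The premises `Inhabited` at the places where a type enters
a derivation ensure that no empty data type occurs in a derivation from the empty context. -/
inductive HasType : Ctx → Exp → FTy → Prop
  | var {Γ : Ctx} {x : Ident} {γ : Ty} :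
      Γ x = some γ → γ.Inhabited →
      HasType Γ (.var x) (.ground γ)
  | lam {Γ : Ctx} {x : Ident} {e : Exp} {γ₁ γ₀ : Ty} :
      γ₁.Inhabited →
      HasType (Function.update Γ x (some γ₁)) e (.ground γ₀) →
      HasType Γ (.lam x e) (.arrow γ₁ γ₀)
  | app {Γ : Ctx} {e₀ e₁ : Exp} {γ₁ γ₀ : Ty} :
      HasType Γ e₀ (.arrow γ₁ γ₀) → HasType Γ e₁ (.ground γ₁) →
      HasType Γ (.app e₀ e₁) (.ground γ₀)
  | unit {Γ : Ctx} : HasType Γ .unit (.ground .unit)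
  | pair {Γ : Ctx} {e₁ e₂ : Exp} {γ₁ γ₂ : Ty} :
      HasType Γ e₁ (.ground γ₁) → HasType Γ e₂ (.ground γ₂) →
      HasType Γ (.pair e₁ e₂) (.ground (.prod γ₁ γ₂))
  | fst {Γ : Ctx} {e : Exp} {γ₁ γ₂ : Ty} :
      HasType Γ e (.ground (.prod γ₁ γ₂)) → HasType Γ (.fst e) (.ground γ₁)
  | snd {Γ : Ctx} {e : Exp} {γ₁ γ₂ : Ty} :
      HasType Γ e (.ground (.prod γ₁ γ₂)) → HasType Γ (.snd e) (.ground γ₂)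
  | inl {Γ : Ctx} {e : Exp} {γ₁ γ₂ : Ty} :
      γ₂.Inhabited → HasType Γ e (.ground γ₁) →
      HasType Γ (.inl e) (.ground (.sum γ₁ γ₂))
  | inr {Γ : Ctx} {e : Exp} {γ₁ γ₂ : Ty} :
      γ₁.Inhabited → HasType Γ e (.ground γ₂) →
      HasType Γ (.inr e) (.ground (.sum γ₁ γ₂))
  | case {Γ : Ctx} {e₀ e₁ e₂ : Exp} {x₁ x₂ : Ident} {γ₁ γ₂ γ : Ty} :
      (Ty.sum γ₁ γ₂).IsNormal ∨ γ.IsSafe →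
      HasType Γ e₀ (.ground (.sum γ₁ γ₂)) →
      HasType (Function.update Γ x₁ (some γ₁)) e₁ (.ground γ) →
      HasType (Function.update Γ x₂ (some γ₂)) e₂ (.ground γ) →
      HasType Γ (.case e₀ x₁ e₁ x₂ e₂) (.ground γ)
  | con {Γ : Ctx} {P : Poly} {e : Exp} :
      (Ty.mu P).Inhabited →
      HasType Γ e (.ground (P.app (.mu P))) →
      HasType Γ (.con P e) (.ground (.mu P))
  | des {Γ : Ctx} {P : Poly} {e : Exp} :
      HasType Γ e (.ground (.mu P)) →
      HasType Γ (.des P e) (.ground (P.app (.mu P)))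
  | fold {Γ : Ctx} {P : Poly} {x : Ident} {e₀ e₁ : Exp} {γ : Ty} :
      HasType Γ (.lam x e₀) (.arrow (P.app γ.safe) γ.safe) →
      HasType Γ e₁ (.ground (.mu P)) →
      HasType Γ (.fold P (.lam x e₀) e₁) (.ground γ.safe)
  | safeCon {Γ : Ctx} {P : Poly} {e : Exp} :
      (Ty.mu P).Inhabited →
      HasType Γ e (.ground (P.app (.mu P)).safe) →
      HasType Γ (.safeCon P e) (.ground (.safeMu P))
  | safeDes {Γ : Ctx} {P : Poly} {e : Exp} :
      HasType Γ e (.ground (.safeMu P)) →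
      HasType Γ (.safeDes P e) (.ground (P.app (.mu P)).safe)
  | toSafe {Γ : Ctx} {e : Exp} {γ : Ty} :
      HasType Γ e (.ground γ) → HasType Γ (.toSafe e) (.ground γ.safe)
  | toNorm {Γ : Ctx} {e : Exp} {γ : Ty} :
      (∀ x ∈ e.fv, ∃ α : Ty, Γ x = some α ∧ α.IsNormal) →
      HasType Γ e (.ground γ) → HasType Γ (.toNorm e) (.ground γ.norm)

/-! ### Value term graphs

A value term graph is given by a heap, i.e. a finite list of labeled vertices whose out-edges are
given by positions in the list, together with the position of its root; the graph consists of
the vertices that are reachable from the root. Several values may live in the same heap and share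
vertices. -/

/-- Vertices are referred to by their positions in the heap. -/
abbrev Loc : Type := ℕ

/-- A vertex with its label and the targets of its out-edges. -/
inductive Node : Type
  | unit : Node
  | inl : Loc → Node
  | inr : Loc → Node
  | pair : Loc → Loc → Node
  | con : Poly → Loc → Node

/-- Heaps; a new vertex is appended at the end, at position `h.length`. -/
abbrev Heap : Type := List Node

/-- The targets of the out-edges of a vertex. -/
def Node.children : Node → Set Loc
  | .unit => ∅
  | .inl l => {l}
  | .inr l => {l}
  | .pair l₁ l₂ => {l₁, l₂}
  | .con _ l => {l}

/-- There is an edge from `l` to `m`. -/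
def Edge (h : Heap) (l m : Loc) : Prop := ∃ n : Node, h[l]? = some n ∧ m ∈ n.children

/-- The size of the value at `l`: the number of vertices of its graph that are labeled by a
data-type constructor. -/
noncomputable def size (h : Heap) (l : Loc) : ℕ :=
  {m : Loc | Relation.ReflTransGen (Edge h) l m ∧
    ∃ (P : Poly) (k : Loc), h[m]? = some (.con P k)}.ncard

/-- The graph rooted at `l` is a value of the (normal) type `γ`. -/
inductive IsNormalValue (h : Heap) : Loc → Ty → Prop
  | unit {l : Loc} : h[l]? = some .unit → IsNormalValue h l .unit
  | inl {l k : Loc} {α β : Ty} :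
      h[l]? = some (.inl k) → IsNormalValue h k α → IsNormalValue h l (.sum α β)
  | inr {l k : Loc} {α β : Ty} :
      h[l]? = some (.inr k) → IsNormalValue h k β → IsNormalValue h l (.sum α β)
  | pair {l k₁ k₂ : Loc} {α β : Ty} :
      h[l]? = some (.pair k₁ k₂) → IsNormalValue h k₁ α → IsNormalValue h k₂ β →
      IsNormalValue h l (.prod α β)
  | con {l k : Loc} {P : Poly} :
      h[l]? = some (.con P k) → IsNormalValue h k (P.app (.mu P)) →
      IsNormalValue h l (.mu P)

/-- The graph rooted at `l` is a type-`γ` value. -/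
def IsValue (h : Heap) (l : Loc) (γ : Ty) : Prop := IsNormalValue h l γ.norm

/-! ### Dynamic-programming evaluation -/

/-- Environments assign values to identifiers. -/
abbrev Env : Type := Ident → Option Loc

/-- The table of the results of a structural recursion that have been computed so far: it maps
vertices of the argument to values. -/
abbrev Memo : Type := Loc → Option Loc

mutual

/-- `Eval h θ e h' v n`: in the heap `h`, the closure `eθ` evaluates under the
dynamic-programming strategy to the value at `v` in the heap `h'`, and the derivation tree of
this evaluation has `n` nodes. -/
inductive Eval : Heap → Env → Exp → Heap → Loc → ℕ → Prop
  | var {h : Heap} {θ : Env} {x : Ident} {v : Loc} :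
      θ x = some v → Eval h θ (.var x) h v 1
  | app {h h₁ h₂ : Heap} {θ : Env} {x : Ident} {e₀ e₁ : Exp} {v₁ v : Loc} {n₁ n₀ : ℕ} :
      Eval h θ e₁ h₁ v₁ n₁ →
      Eval h₁ (Function.update θ x (some v₁)) e₀ h₂ v n₀ →
      Eval h θ (.app (.lam x e₀) e₁) h₂ v (1 + n₁ + n₀)
  | unit {h : Heap} {θ : Env} : Eval h θ .unit (h ++ [.unit]) h.length 1
  | pair {h h₁ h₂ : Heap} {θ : Env} {e₁ e₂ : Exp} {v₁ v₂ : Loc} {n₁ n₂ : ℕ} :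
      Eval h θ e₁ h₁ v₁ n₁ → Eval h₁ θ e₂ h₂ v₂ n₂ →
      Eval h θ (.pair e₁ e₂) (h₂ ++ [.pair v₁ v₂]) h₂.length (1 + n₁ + n₂)
  | fst {h h₁ : Heap} {θ : Env} {e : Exp} {v v₁ v₂ : Loc} {n : ℕ} :
      Eval h θ e h₁ v n → h₁[v]? = some (.pair v₁ v₂) →
      Eval h θ (.fst e) h₁ v₁ (1 + n)
  | snd {h h₁ : Heap} {θ : Env} {e : Exp} {v v₁ v₂ : Loc} {n : ℕ} :
      Eval h θ e h₁ v n → h₁[v]? = some (.pair v₁ v₂) →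
      Eval h θ (.snd e) h₁ v₂ (1 + n)
  | inl {h h₁ : Heap} {θ : Env} {e : Exp} {v : Loc} {n : ℕ} :
      Eval h θ e h₁ v n →
      Eval h θ (.inl e) (h₁ ++ [.inl v]) h₁.length (1 + n)
  | inr {h h₁ : Heap} {θ : Env} {e : Exp} {v : Loc} {n : ℕ} :
      Eval h θ e h₁ v n →
      Eval h θ (.inr e) (h₁ ++ [.inr v]) h₁.length (1 + n)
  | caseInl {h h₁ h₂ : Heap} {θ : Env} {e₀ e₁ e₂ : Exp} {x₁ x₂ : Ident} {v₀ k v : Loc}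
      {n₀ n : ℕ} :
      Eval h θ e₀ h₁ v₀ n₀ → h₁[v₀]? = some (.inl k) →
      Eval h₁ (Function.update θ x₁ (some k)) e₁ h₂ v n →
      Eval h θ (.case e₀ x₁ e₁ x₂ e₂) h₂ v (1 + n₀ + n)
  | caseInr {h h₁ h₂ : Heap} {θ : Env} {e₀ e₁ e₂ : Exp} {x₁ x₂ : Ident} {v₀ k v : Loc}
      {n₀ n : ℕ} :
      Eval h θ e₀ h₁ v₀ n₀ → h₁[v₀]? = some (.inr k) →
      Eval h₁ (Function.update θ x₂ (some k)) e₂ h₂ v n →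
      Eval h θ (.case e₀ x₁ e₁ x₂ e₂) h₂ v (1 + n₀ + n)
  | con {h h₁ : Heap} {θ : Env} {P : Poly} {e : Exp} {v : Loc} {n : ℕ} :
      Eval h θ e h₁ v n →
      Eval h θ (.con P e) (h₁ ++ [.con P v]) h₁.length (1 + n)
  | des {h h₁ : Heap} {θ : Env} {P : Poly} {e : Exp} {v k : Loc} {n : ℕ} :
      Eval h θ e h₁ v n → h₁[v]? = some (.con P k) →
      Eval h θ (.des P e) h₁ k (1 + n)
  /-- The argument is evaluated, and then the recursion runs through its graph, starting with
  an empty table. -/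
  | fold {h h₁ h₂ : Heap} {θ : Env} {P : Poly} {x : Ident} {e₀ e₁ : Exp} {v₁ v : Loc}
      {M : Memo} {n₁ n : ℕ} :
      Eval h θ e₁ h₁ v₁ n₁ →
      FoldMap P x e₀ θ h₁ (fun _ => none) .id v₁ h₂ M v n →
      Eval h θ (.fold P (.lam x e₀) e₁) h₂ v (1 + n₁ + n)
  | safeCon {h h₁ : Heap} {θ : Env} {P : Poly} {e : Exp} {v : Loc} {n : ℕ} :
      Eval h θ e h₁ v n →
      Eval h θ (.safeCon P e) (h₁ ++ [.con P v]) h₁.length (1 + n)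
  | safeDes {h h₁ : Heap} {θ : Env} {P : Poly} {e : Exp} {v k : Loc} {n : ℕ} :
      Eval h θ e h₁ v n → h₁[v]? = some (.con P k) →
      Eval h θ (.safeDes P e) h₁ k (1 + n)
  | toSafe {h h₁ : Heap} {θ : Env} {e : Exp} {v : Loc} {n : ℕ} :
      Eval h θ e h₁ v n → Eval h θ (.toSafe e) h₁ v (1 + n)
  | toNorm {h h₁ : Heap} {θ : Env} {e : Exp} {v : Loc} {n : ℕ} :
      Eval h θ e h₁ v n → Eval h θ (.toNorm e) h₁ v (1 + n)

/-- `FoldMap P x e₀ θ h M Q l h' M' v n`: the evaluation, in the heap `h` and with the table `M`,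
of `Q(fold_{μP} (λx.e₀))θ` on the value at `l`, which is of type `Q(μP)`. It yields the value at
`v` in the heap `h'` and the table `M'`, and its derivation tree has `n` nodes. The case
`Q = Id` is the recursion itself: a result found in the table is looked up, and otherwise it is
computed by the equation `fold f (C u) = f (P(fold f) u)` and saved in the table. So the
step function is evaluated exactly once for each vertex at which the recursion arrives. -/
inductive FoldMap : Poly → Ident → Exp → Env → Heap → Memo → Poly → Loc →
    Heap → Memo → Loc → ℕ → Prop
  | lookup {P : Poly} {x : Ident} {e₀ : Exp} {θ : Env} {h : Heap} {M : Memo} {l v : Loc} :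
      M l = some v →
      FoldMap P x e₀ θ h M .id l h M v 1
  | step {P : Poly} {x : Ident} {e₀ : Exp} {θ : Env} {h h₁ h₂ : Heap} {M M₁ : Memo}
      {l k u v : Loc} {n₁ n₀ : ℕ} :
      M l = none → h[l]? = some (.con P k) →
      FoldMap P x e₀ θ h M P k h₁ M₁ u n₁ →
      Eval h₁ (Function.update θ x (some u)) e₀ h₂ v n₀ →
      FoldMap P x e₀ θ h M .id l h₂ (Function.update M₁ l (some v)) v (1 + n₁ + n₀)
  | constUnit {P : Poly} {x : Ident} {e₀ : Exp} {θ : Env} {h : Heap} {M : Memo} {l : Loc} :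
      FoldMap P x e₀ θ h M .constUnit l h M l 1
  | constMu {P R : Poly} {x : Ident} {e₀ : Exp} {θ : Env} {h : Heap} {M : Memo} {l : Loc} :
      FoldMap P x e₀ θ h M (.constMu R) l h M l 1
  | sumInl {P Q R : Poly} {x : Ident} {e₀ : Exp} {θ : Env} {h h₁ : Heap} {M M₁ : Memo}
      {l k v : Loc} {n : ℕ} :
      h[l]? = some (.inl k) →
      FoldMap P x e₀ θ h M Q k h₁ M₁ v n →
      FoldMap P x e₀ θ h M (.sum Q R) l (h₁ ++ [.inl v]) M₁ h₁.length (1 + n)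
  | sumInr {P Q R : Poly} {x : Ident} {e₀ : Exp} {θ : Env} {h h₁ : Heap} {M M₁ : Memo}
      {l k v : Loc} {n : ℕ} :
      h[l]? = some (.inr k) →
      FoldMap P x e₀ θ h M R k h₁ M₁ v n →
      FoldMap P x e₀ θ h M (.sum Q R) l (h₁ ++ [.inr v]) M₁ h₁.length (1 + n)
  | prod {P Q R : Poly} {x : Ident} {e₀ : Exp} {θ : Env} {h h₁ h₂ : Heap} {M M₁ M₂ : Memo}
      {l k₁ k₂ v₁ v₂ : Loc} {n₁ n₂ : ℕ} :
      h[l]? = some (.pair k₁ k₂) →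
      FoldMap P x e₀ θ h M Q k₁ h₁ M₁ v₁ n₁ →
      FoldMap P x e₀ θ h₁ M₁ R k₂ h₂ M₂ v₂ n₂ →
      FoldMap P x e₀ θ h M (.prod Q R) l (h₂ ++ [.pair v₁ v₂]) M₂ h₂.length (1 + n₁ + n₂)

end

/-- The environment for a single variable `x` with the value at `l`. -/
def Env.single (x : Ident) (l : Loc) : Env := Function.update (fun _ => none) x (some l)

/-- A closed `f : γ₁ → γ₀` is DP-poly-cost: there is one polynomial `q` such that, for every
environment `θ` that assigns to a variable `x` a type-`γ₁` value, the closure `(f x)θ` has a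
value under dynamic-programming evaluation, and the cost of its evaluation is at most `q` of the
size of `θ(x)`. -/
def DPPolyCost (f : Exp) (γ₁ : Ty) : Prop :=
  ∃ q : Polynomial ℕ, ∀ (x : Ident) (h : Heap) (l : Loc), IsValue h l γ₁ →
    (∃ (h' : Heap) (v : Loc) (n : ℕ), Eval h (Env.single x l) (.app f (.var x)) h' v n) ∧
    ∀ (h' : Heap) (v : Loc) (n : ℕ), Eval h (Env.single x l) (.app f (.var x)) h' v n →
      n ≤ q.eval (size h l)

end RSMinus

namespace RSMinus

/-! ### Types -/

-- Safe data do not enter the bounds. An environment is measured by a number `s` bounding, for each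
-- variable, the constructor vertices in the normal part of its value (`normalVertices`,
-- `EnvBound`). By induction on typing (`HasType.sound`), cost and normal part of the result are
-- both at most a polynomial in `s`. Binding a variable only composes polynomials; nothing is ever
-- iterated.
--
-- Recursion is the critical case. Its argument is normal, so it has at most polynomially many
-- constructor vertices; counting vertices instead of tree nodes is what the table of saved results
-- permits. The step function receives recursive results at safe type, which measure zero, together
-- with constants of `P`, which are parts of the argument. So a single bound `b` serves at all
-- vertices, and each of them is charged `P.nodes + b` once (`exists_foldOutcome`, `Outcome.fold`).
--
-- The other danger is `toNorm`, which makes safe data count. A derivation node creates at most one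
-- vertex, so a value consists of new vertices, no more than the cost, and of vertices reachable
-- from the free variables. These have normal types, hence at most `s` constructor vertices each
-- (`Outcome.toNorm`). The invariant `closed` keeps track of this reachability.
--
-- Evaluations exist because the typing derivation of a value is well founded and drives the
-- recursion; determinism carries the bound from the constructed evaluation to all others.

theorem Ty.norm_norm (γ : Ty) : γ.norm.norm = γ.norm := by
  induction γ <;> simp_all [Ty.norm]

theorem Ty.norm_safe (γ : Ty) : γ.safe.norm = γ.norm := by
  induction γ <;> simp_all [Ty.norm, Ty.safe]

theorem Ty.IsNormal.norm_eq {γ : Ty} (hγ : γ.IsNormal) : γ.norm = γ := by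
  induction γ <;> simp_all [Ty.norm, Ty.IsNormal]

theorem Poly.norm_app (P : Poly) (γ : Ty) : (P.app γ).norm = P.app γ.norm := by
  induction P <;> simp_all [Ty.norm, Poly.app]

theorem Poly.norm_app_mu (P Q : Poly) : (P.app (.mu Q)).norm = P.app (.mu Q) :=
  P.norm_app _

/-- The number of nodes of a polynomial functor. -/
def Poly.nodes : Poly → ℕ
  | .id => 1
  | .constUnit => 1
  | .constMu _ => 1
  | .sum P Q => 1 + P.nodes + Q.nodes
  | .prod P Q => 1 + P.nodes + Q.nodes

/-! ### Heaps -/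

theorem getElem?_of_prefix {h h' : Heap} (hp : h <+: h') {l : Loc} {nd : Node}
    (hl : h[l]? = some nd) : h'[l]? = some nd := by
  obtain ⟨t, rfl⟩ := hp
  have : l < h.length := (List.getElem?_eq_some_iff.1 hl).1
  rw [List.getElem?_append_left this, hl]

theorem IsNormalValue.mono {h h' : Heap} (hp : h <+: h') {l : Loc} {γ : Ty}
    (hv : IsNormalValue h l γ) : IsNormalValue h' l γ := by
  induction hv with
  | unit hl => exact .unit (getElem?_of_prefix hp hl)
  | inl hl _ ih => exact .inl (getElem?_of_prefix hp hl) ih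
  | inr hl _ ih => exact .inr (getElem?_of_prefix hp hl) ih
  | pair hl _ _ ih₁ ih₂ => exact .pair (getElem?_of_prefix hp hl) ih₁ ih₂
  | con hl _ ih => exact .con (getElem?_of_prefix hp hl) ih

/-- A set of vertices of the heap that contains the targets of all out-edges of its members. -/
def Closed (h : Heap) (S : Set Loc) : Prop :=
  ∀ l ∈ S, ∃ nd : Node, h[l]? = some nd ∧ nd.children ⊆ S

theorem Closed.mono {h h' : Heap} (hp : h <+: h') {S : Set Loc} (hS : Closed h S) :
    Closed h' S := fun l hl => by
  obtain ⟨nd, h₁, h₂⟩ := hS l hl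
  exact ⟨nd, getElem?_of_prefix hp h₁, h₂⟩

/-- A path starting in a closed set never leaves it, and old vertices keep their out-edges when the
heap grows. So newly allocated vertices are not reachable from old values. -/
theorem Closed.reach {h h' : Heap} (hp : h <+: h') {S : Set Loc} (hS : Closed h S) {l m : Loc}
    (hl : l ∈ S) (hm : Relation.ReflTransGen (Edge h') l m) :
    m ∈ S ∧ Relation.ReflTransGen (Edge h) l m := by
  induction hm with
  | refl => exact ⟨hl, .refl⟩
  | tail _ he ih =>
    obtain ⟨nd, h₁, h₂⟩ := hS _ ih.1
    obtain ⟨nd', h₃, h₄⟩ := he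
    obtain rfl : nd = nd' := by simpa [getElem?_of_prefix hp h₁] using h₃
    exact ⟨h₂ h₄, ih.2.tail ⟨nd, h₁, h₄⟩⟩

-- Values as closed acyclic graphs

theorem IsNormalValue.exists_node {h : Heap} {l : Loc} {γ : Ty} (hv : IsNormalValue h l γ) :
    ∃ nd : Node, h[l]? = some nd ∧ ∀ k ∈ nd.children, ∃ α, IsNormalValue h k α := by
  cases hv with
  | unit hl => exact ⟨_, hl, by simp [Node.children]⟩
  | inl hl h₁ => exact ⟨_, hl, by simpa [Node.children] using ⟨_, h₁⟩⟩
  | inr hl h₁ => exact ⟨_, hl, by simpa [Node.children] using ⟨_, h₁⟩⟩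
  | pair hl h₁ h₂ => exact ⟨_, hl, by simpa [Node.children] using ⟨⟨_, h₁⟩, ⟨_, h₂⟩⟩⟩
  | con hl h₁ => exact ⟨_, hl, by simpa [Node.children] using ⟨_, h₁⟩⟩

theorem IsNormalValue.closed {h : Heap} {l : Loc} {γ : Ty} (hv : IsNormalValue h l γ) :
    Closed h {m | Relation.ReflTransGen (Edge h) l m} := by
  intro m hm
  have key : ∃ α, IsNormalValue h m α := by
    have hm' : Relation.ReflTransGen (Edge h) l m := hm
    clear hm
    induction hm' with
    | refl => exact ⟨γ, hv⟩
    | tail _ he ih =>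
      obtain ⟨α, hα⟩ := ih
      obtain ⟨nd, h₁, h₂⟩ := hα.exists_node
      obtain ⟨nd', h₃, h₄⟩ := he
      obtain rfl : nd = nd' := by simpa [h₁] using h₃
      exact h₂ _ h₄
  obtain ⟨α, hα⟩ := key
  obtain ⟨nd, h₁, _⟩ := hα.exists_node
  exact ⟨nd, h₁, fun k hk => Relation.ReflTransGen.tail hm ⟨nd, h₁, hk⟩⟩

theorem IsNormalValue.acc {h : Heap} {l : Loc} {γ : Ty} (hv : IsNormalValue h l γ) :
    Acc (fun a b => Edge h b a) l := by
  induction hv with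
  | unit hl =>
    refine ⟨_, fun m hm => ?_⟩
    obtain ⟨nd, h₁, h₂⟩ := hm
    obtain rfl : _ = nd := by simpa [hl] using h₁
    simp [Node.children] at h₂
  | inl hl _ ih | inr hl _ ih | con hl _ ih =>
    refine ⟨_, fun m hm => ?_⟩
    obtain ⟨nd, h₁, h₂⟩ := hm
    obtain rfl : _ = nd := by simpa [hl] using h₁
    obtain rfl : m = _ := by simpa [Node.children] using h₂
    exact ih
  | pair hl _ _ ih₁ ih₂ =>
    refine ⟨_, fun m hm => ?_⟩
    obtain ⟨nd, h₁, h₂⟩ := hm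
    obtain rfl : _ = nd := by simpa [hl] using h₁
    obtain rfl | rfl : m = _ ∨ m = _ := by simpa [Node.children] using h₂
    · exact ih₁
    · exact ih₂

/-- Typing is inductive, so values are acyclic. In a recursion this ensures that no result for a
vertex is saved while its descendants are being processed. -/
theorem IsNormalValue.not_reach_of_edge {h : Heap} {l k : Loc} {γ : Ty}
    (hv : IsNormalValue h l γ) (he : Edge h l k) : ¬ Relation.ReflTransGen (Edge h) k l := by
  intro hk
  -- An accessible point lies on no cycle: a cycle through `a` makes `a` its own predecessor, to
  -- which the induction hypothesis applies.
  have key : ∀ a, Acc (Relation.TransGen fun a b => Edge h b a) a →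
      ¬ Relation.TransGen (fun a b => Edge h b a) a a := by
    intro a ha
    induction ha with
    | intro a _ ih => exact fun hr => ih a hr hr
  refine key l hv.acc.transGen ?_
  have : Relation.TransGen (Edge h) l l := Relation.TransGen.head' he hk
  exact Relation.transGen_swap.2 this

/-! ### Data-type vertices -/

/-- The vertices of the graph at `l` that are labeled by a constructor of a data type. -/
def conVertices (h : Heap) (l : Loc) : Set Loc :=
  {m : Loc | Relation.ReflTransGen (Edge h) l m ∧
    ∃ (P : Poly) (k : Loc), h[m]? = some (.con P k)}

theorem conVertices_finite (h : Heap) (l : Loc) : (conVertices h l).Finite :=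
  (Set.finite_Iio h.length).subset fun m hm => by
    obtain ⟨_, P, k, hk⟩ := hm
    exact (List.getElem?_eq_some_iff.1 hk).1

theorem conVertices_subset_of_edge {h : Heap} {l k : Loc} (he : Edge h l k) :
    conVertices h k ⊆ conVertices h l :=
  fun _ hm => ⟨.head he hm.1, hm.2⟩

theorem mem_conVertices_cases {h : Heap} {l m : Loc} {nd : Node} (hl : h[l]? = some nd)
    (hm : m ∈ conVertices h l) :
    m = l ∧ (∃ P k, nd = .con P k) ∨ ∃ k ∈ nd.children, m ∈ conVertices h k := by
  obtain ⟨hr, P, j, hj⟩ := hm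
  rcases hr.cases_head with rfl | ⟨k, ⟨nd', h₁, h₂⟩, hk⟩
  · rw [hl] at hj
    exact .inl ⟨rfl, P, j, by simpa using hj⟩
  · obtain rfl : nd = nd' := by simpa [hl] using h₁
    exact .inr ⟨k, h₂, hk, P, j, hj⟩

theorem IsNormalValue.conVertices_eq {h h' : Heap} (hp : h <+: h') {l : Loc} {γ : Ty}
    (hv : IsNormalValue h l γ) : conVertices h' l = conVertices h l := by
  ext m
  constructor
  · rintro ⟨hr, P, k, hk⟩
    obtain ⟨hm, _⟩ := hv.closed.reach hp .refl hr
    obtain ⟨nd, h₁, _⟩ := hv.closed m hm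
    have : nd = .con P k := by simpa [getElem?_of_prefix hp h₁] using hk
    exact ⟨hm, P, k, this ▸ h₁⟩
  · rintro ⟨hr, P, k, hk⟩
    refine ⟨Relation.ReflTransGen.mono ?_ _ _ hr, P, k, getElem?_of_prefix hp hk⟩
    exact fun _ _ ⟨nd, h₁, h₂⟩ => ⟨nd, getElem?_of_prefix hp h₁, h₂⟩

/-- The data-type vertices of the graph at `l` that belong to a normal constituent of the
type. -/
def normalVertices (h : Heap) : Loc → Ty → Set Loc
  | _, .unit => ∅
  | l, .mu _ => conVertices h l
  | _, .safeUnit => ∅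
  | _, .safeMu _ => ∅
  | l, .sum α β => {m | (∃ k, h[l]? = some (.inl k) ∧ m ∈ normalVertices h k α) ∨
      ∃ k, h[l]? = some (.inr k) ∧ m ∈ normalVertices h k β}
  | l, .prod α β => {m | ∃ k₁ k₂, h[l]? = some (.pair k₁ k₂) ∧
      (m ∈ normalVertices h k₁ α ∨ m ∈ normalVertices h k₂ β)}

theorem normalVertices_inl {h : Heap} {l k : Loc} (hl : h[l]? = some (.inl k)) (α β : Ty) :
    normalVertices h l (.sum α β) = normalVertices h k α := by
  ext m; simp [normalVertices, hl]

theorem normalVertices_inr {h : Heap} {l k : Loc} (hl : h[l]? = some (.inr k)) (α β : Ty) :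
    normalVertices h l (.sum α β) = normalVertices h k β := by
  ext m; simp [normalVertices, hl]

theorem normalVertices_pair {h : Heap} {l k₁ k₂ : Loc} (hl : h[l]? = some (.pair k₁ k₂))
    (α β : Ty) :
    normalVertices h l (.prod α β) = normalVertices h k₁ α ∪ normalVertices h k₂ β := by
  ext m
  simp only [normalVertices, hl, Set.mem_ofPred_eq, Set.mem_union, Option.some.injEq,
    Node.pair.injEq]
  constructor
  · rintro ⟨_, _, ⟨rfl, rfl⟩, hm⟩
    exact hm
  · exact fun hm => ⟨_, _, ⟨rfl, rfl⟩, hm⟩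

/-- The reason why recursive results may grow without affecting the bounds. -/
theorem normalVertices_safe (h : Heap) (l : Loc) (γ : Ty) : normalVertices h l γ.safe = ∅ := by
  induction γ generalizing l <;> simp_all [normalVertices, Ty.safe]

theorem normalVertices_subset (h : Heap) (l : Loc) (γ : Ty) :
    normalVertices h l γ ⊆ conVertices h l := by
  induction γ generalizing l with
  | unit | safeUnit | safeMu => exact Set.empty_subset _
  | mu => exact subset_rfl
  | sum α β ihα ihβ =>
    rintro m (⟨k, hk, hm⟩ | ⟨k, hk, hm⟩)
    · exact conVertices_subset_of_edge ⟨_, hk, rfl⟩ (ihα k hm)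
    · exact conVertices_subset_of_edge ⟨_, hk, rfl⟩ (ihβ k hm)
  | prod α β ihα ihβ =>
    rintro m ⟨k₁, k₂, hk, hm | hm⟩
    · exact conVertices_subset_of_edge ⟨_, hk, .inl rfl⟩ (ihα k₁ hm)
    · exact conVertices_subset_of_edge ⟨_, hk, .inr rfl⟩ (ihβ k₂ hm)

theorem normalVertices_finite (h : Heap) (l : Loc) (γ : Ty) : (normalVertices h l γ).Finite :=
  (conVertices_finite h l).subset (normalVertices_subset h l γ)

/-- `IsNormalValue` holds only at types without safe marks, so there is no constituent in which a
constructor vertex could be hidden from the count. -/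
theorem IsNormalValue.conVertices_subset {h : Heap} {l : Loc} {γ : Ty}
    (hv : IsNormalValue h l γ) : conVertices h l ⊆ normalVertices h l γ := by
  induction hv with
  | unit hl =>
    intro m hm
    rcases mem_conVertices_cases hl hm with ⟨_, P, k, hk⟩ | ⟨k, hk, _⟩
    · simp at hk
    · simp [Node.children] at hk
  | inl hl _ ih =>
    intro m hm
    rw [normalVertices_inl hl]
    rcases mem_conVertices_cases hl hm with ⟨_, P, k, hk⟩ | ⟨k, rfl, hk⟩
    · simp at hk
    · exact ih hk
  | inr hl _ ih =>
    intro m hm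
    rw [normalVertices_inr hl]
    rcases mem_conVertices_cases hl hm with ⟨_, P, k, hk⟩ | ⟨k, rfl, hk⟩
    · simp at hk
    · exact ih hk
  | pair hl _ _ ih₁ ih₂ =>
    intro m hm
    rw [normalVertices_pair hl]
    rcases mem_conVertices_cases hl hm with ⟨_, P, k, hk⟩ | ⟨k, rfl | rfl, hk⟩
    · simp at hk
    · exact .inl (ih₁ hk)
    · exact .inr (ih₂ hk)
  | con => exact subset_rfl

theorem IsValue.mono {h h' : Heap} (hp : h <+: h') {l : Loc} {γ : Ty} (hv : IsValue h l γ) :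
    IsValue h' l γ := IsNormalValue.mono hp hv

/-- Allocation leaves the measure of existing values unchanged, so bounds obtained in one heap
persist through later evaluations. -/
theorem IsValue.normalVertices_eq {h h' : Heap} (hp : h <+: h') {l : Loc} {γ : Ty}
    (hv : IsValue h l γ) : normalVertices h' l γ = normalVertices h l γ := by
  induction γ generalizing l with
  | unit | safeUnit | safeMu => rfl
  | mu => exact IsNormalValue.conVertices_eq hp hv
  | sum α β ihα ihβ =>
    cases hv with
    | inl hl hk =>
      rw [normalVertices_inl hl, normalVertices_inl (getElem?_of_prefix hp hl), ihα hk]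
    | inr hl hk =>
      rw [normalVertices_inr hl, normalVertices_inr (getElem?_of_prefix hp hl), ihβ hk]
  | prod α β ihα ihβ =>
    cases hv with
    | pair hl h₁ h₂ =>
      rw [normalVertices_pair hl, normalVertices_pair (getElem?_of_prefix hp hl), ihα h₁,
        ihβ h₂]

/-! ### Environments -/

/-- The environment assigns values of the types given by the context, and the normal part of
each of them has at most `s` data-type vertices. -/
def EnvBound (Γ : Ctx) (θ : Env) (h : Heap) (s : ℕ) : Prop :=
  ∀ x γ, Γ x = some γ →
    ∃ l, θ x = some l ∧ IsValue h l γ ∧ (normalVertices h l γ).ncard ≤ s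

theorem EnvBound.mono {Γ : Ctx} {θ : Env} {h h' : Heap} {s s' : ℕ} (hE : EnvBound Γ θ h s)
    (hp : h <+: h') (hs : s ≤ s') : EnvBound Γ θ h' s' := by
  intro x γ hx
  obtain ⟨l, h₁, h₂, h₃⟩ := hE x γ hx
  exact ⟨l, h₁, h₂.mono hp, by rw [h₂.normalVertices_eq hp]; omega⟩

theorem EnvBound.update {Γ : Ctx} {θ : Env} {h : Heap} {s : ℕ} (hE : EnvBound Γ θ h s)
    {l : Loc} {γ : Ty} (hv : IsValue h l γ) (hs : (normalVertices h l γ).ncard ≤ s)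
    (x : Ident) :
    EnvBound (Function.update Γ x (some γ)) (Function.update θ x (some l)) h s := by
  intro y α hy
  by_cases hxy : y = x
  · subst hxy
    obtain rfl : γ = α := by simpa using hy
    exact ⟨l, by simp, hv, hs⟩
  · rw [Function.update_of_ne hxy] at hy
    rw [Function.update_of_ne hxy]
    exact hE y α hy

/-- `S` together with the vertices of `h'` that are not in `h`. -/
def grow (h h' : Heap) (S : Set Loc) : Set Loc := S ∪ Set.Ico h.length h'.length

theorem subset_grow (h h' : Heap) (S : Set Loc) : S ⊆ grow h h' S := Set.subset_union_left

theorem grow_self (h : Heap) (S : Set Loc) : grow h h S = S := by simp [grow]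

/-- Lets the reachability invariants of consecutive evaluations be chained. -/
theorem grow_grow {h₀ h₁ h₂ : Heap} (h₀₁ : h₀ <+: h₁) (h₁₂ : h₁ <+: h₂) (S : Set Loc) :
    grow h₁ h₂ (grow h₀ h₁ S) = grow h₀ h₂ S := by
  rw [grow, grow, grow, Set.union_assoc, Set.Ico_union_Ico_eq_Ico h₀₁.length_le h₁₂.length_le]

theorem mem_grow_append {h h₁ : Heap} (hp : h <+: h₁) (S : Set Loc) (nd : Node) :
    h₁.length ∈ grow h (h₁ ++ [nd]) S :=
  .inr ⟨hp.length_le, by simp⟩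

theorem grow_subset_append (h h₁ : Heap) (S : Set Loc) (nd : Node) :
    grow h h₁ S ⊆ grow h (h₁ ++ [nd]) S :=
  Set.union_subset_union_right _ (Set.Ico_subset_Ico_right (by simp))

theorem Closed.append {h h₁ : Heap} {S : Set Loc}
    (hS : Closed h₁ (grow h h₁ S)) {nd : Node} (hnd : nd.children ⊆ grow h h₁ S) :
    Closed (h₁ ++ [nd]) (grow h (h₁ ++ [nd]) S) := by
  have hsub := grow_subset_append h h₁ S nd
  intro l hl
  by_cases hlt : l ∈ grow h h₁ S
  · obtain ⟨nd', h₂, h₃⟩ := (hS.mono (List.prefix_append h₁ [nd])) l hlt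
    exact ⟨nd', h₂, h₃.trans hsub⟩
  · rcases hl with hl | ⟨hl, hl'⟩
    · exact absurd (.inl hl) hlt
    · have : l = h₁.length := by
        have : ¬ l < h₁.length := fun hh => hlt (.inr ⟨hl, hh⟩)
        exact le_antisymm (Nat.le_of_lt_succ (by simpa using hl')) (not_lt.1 this)
      subst this
      exact ⟨nd, by simp, hnd.trans hsub⟩

/-- The environment maps the identifiers of `V` into `S`. -/
def MapsInto (θ : Env) (V : Finset Ident) (S : Set Loc) : Prop :=
  ∀ x ∈ V, ∀ l, θ x = some l → l ∈ S

theorem MapsInto.mono {θ : Env} {V W : Finset Ident} {S T : Set Loc} (hm : MapsInto θ W S)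
    (hV : V ⊆ W) (hS : S ⊆ T) : MapsInto θ V T :=
  fun x hx l hl => hS (hm x (hV hx) l hl)

theorem MapsInto.update {θ : Env} {V : Finset Ident} {S : Set Loc} {x : Ident} {k : Loc}
    (hm : MapsInto θ (V.erase x) S) (hk : k ∈ S) :
    MapsInto (Function.update θ x (some k)) V S := by
  intro y hy l hl
  by_cases hxy : y = x
  · subst hxy
    obtain rfl : k = l := by simpa using hl
    exact hk
  · rw [Function.update_of_ne hxy] at hl
    exact hm y (Finset.mem_erase.2 ⟨hxy, hy⟩) l hl

/-! ### Outcomes of evaluations -/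

/-- `eθ` has a unique evaluation; its value has type `γ`, and its new vertices point only to new
vertices and to vertices that are reachable from the free variables of `e`. The cost and the
normal part of the value are bounded by `b`. -/
structure Outcome (h : Heap) (θ : Env) (e : Exp) (γ : Ty) (b : ℕ) (h' : Heap) (v : Loc)
    (n : ℕ) : Prop where
  eval : Eval h θ e h' v n
  unique : ∀ h'' v'' n'', Eval h θ e h'' v'' n'' → h'' = h' ∧ v'' = v ∧ n'' = n
  pre : h <+: h'
  -- Each derivation node allocates at most one vertex; this turns the cost bound into a bound on
  -- the new part of a value.
  length_le : h'.length ≤ h.length + n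
  value : IsValue h' v γ
  -- Quantifying over all closed `S`, not only the set reachable from the free variables, makes the
  -- statement composable: the grown set of one evaluation is the `S` of the next.
  closed : ∀ S, Closed h S → MapsInto θ e.fv S →
    Closed h' (grow h h' S) ∧ v ∈ grow h h' S
  cost_le : n ≤ b
  normal_le : (normalVertices h' v γ).ncard ≤ b

/-- The evaluation of `e` in environments for `Γ` is polynomially bounded in the normal parts of
the values of the variables. -/
def PolyBounded (Γ : Ctx) (e : Exp) (γ : Ty) : Prop :=
  ∃ q : Polynomial ℕ, ∀ (h : Heap) (θ : Env) (s : ℕ), EnvBound Γ θ h s →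
    ∃ h' v n, Outcome h θ e γ (q.eval s) h' v n

namespace Outcome

variable {h h₁ h₂ : Heap} {θ : Env} {b b₁ b₂ : ℕ} {v v₁ v₂ k : Loc} {n n₁ n₂ : ℕ} {e e₀ e₁ e₂ : Exp}
  {γ γ₁ γ₂ : Ty} {x : Ident}

-- Outcomes of the individual term formers

theorem mono (o : Outcome h θ e γ b h₁ v n) {c : ℕ} (hbc : b ≤ c) :
    Outcome h θ e γ c h₁ v n :=
  { o with cost_le := o.cost_le.trans hbc, normal_le := o.normal_le.trans hbc }

theorem var (hx : θ x = some v) (hv : IsValue h v γ)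
    (hs : (normalVertices h v γ).ncard ≤ b) :
    Outcome h θ (.var x) γ (b + 1) h v 1 where
  eval := .var hx
  unique := by
    intro h'' v'' n'' H
    cases H with
    | var hx' => rw [hx] at hx'; simp_all
  pre := List.prefix_rfl
  length_le := by simp
  value := hv
  closed S hS hθ := by
    rw [grow_self]
    exact ⟨hS, hθ x (by simp [Exp.fv]) v hx⟩
  cost_le := by omega
  normal_le := by omega

theorem app (o₁ : Outcome h θ e₁ γ₁ b₁ h₁ v₁ n₁)
    (o₂ : Outcome h₁ (Function.update θ x (some v₁)) e₀ γ b₂ h₂ v n₂) :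
    Outcome h θ (.app (.lam x e₀) e₁) γ (1 + b₁ + b₂) h₂ v (1 + n₁ + n₂) where
  eval := .app o₁.eval o₂.eval
  unique := by
    intro h'' v'' n'' H
    cases H with
    | app H₁ H₂ =>
      obtain ⟨rfl, rfl, rfl⟩ := o₁.unique _ _ _ H₁
      obtain ⟨rfl, rfl, rfl⟩ := o₂.unique _ _ _ H₂
      simp
  pre := o₁.pre.trans o₂.pre
  length_le := by have := o₁.length_le; have := o₂.length_le; omega
  value := o₂.value
  closed S hS hθ := by
    obtain ⟨c₁, m₁⟩ := o₁.closed S hS (hθ.mono (by simp [Exp.fv]) subset_rfl)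
    have := o₂.closed _ c₁
      (MapsInto.update (hθ.mono (by simp [Exp.fv]) (subset_grow _ _ _)) m₁)
    rwa [grow_grow o₁.pre o₂.pre] at this
  cost_le := by have := o₁.cost_le; have := o₂.cost_le; omega
  normal_le := by have := o₂.normal_le; omega

theorem unit : Outcome h θ .unit .unit 1 (h ++ [.unit]) h.length 1 where
  eval := .unit
  unique := by
    intro h'' v'' n'' H
    cases H
    simp
  pre := List.prefix_append _ _
  length_le := by simp
  value := .unit (by simp)
  closed S hS _ :=
    ⟨Closed.append (by rwa [grow_self]) (by simp [Node.children]),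
      mem_grow_append List.prefix_rfl _ _⟩
  cost_le := le_rfl
  normal_le := by simp [normalVertices]

theorem pair (o₁ : Outcome h θ e₁ γ₁ b₁ h₁ v₁ n₁) (o₂ : Outcome h₁ θ e₂ γ₂ b₂ h₂ v₂ n₂) :
    Outcome h θ (.pair e₁ e₂) (.prod γ₁ γ₂) (1 + b₁ + b₂) (h₂ ++ [.pair v₁ v₂]) h₂.length
      (1 + n₁ + n₂) where
  eval := .pair o₁.eval o₂.eval
  unique := by
    intro h'' v'' n'' H
    cases H with
    | pair H₁ H₂ =>
      obtain ⟨rfl, rfl, rfl⟩ := o₁.unique _ _ _ H₁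
      obtain ⟨rfl, rfl, rfl⟩ := o₂.unique _ _ _ H₂
      simp
  pre := (o₁.pre.trans o₂.pre).trans (List.prefix_append _ _)
  length_le := by have := o₁.length_le; have := o₂.length_le; simp; omega
  value := .pair (by simp) (o₁.value.mono (o₂.pre.trans (List.prefix_append _ _)))
    (o₂.value.mono (List.prefix_append _ _))
  closed S hS hθ := by
    obtain ⟨c₁, m₁⟩ := o₁.closed S hS (hθ.mono (by simp [Exp.fv]) subset_rfl)
    obtain ⟨c₂, m₂⟩ := o₂.closed _ c₁ (hθ.mono (by simp [Exp.fv]) (subset_grow _ _ _))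
    have hm := subset_grow h₁ h₂ _ m₁
    rw [grow_grow o₁.pre o₂.pre] at c₂ m₂ hm
    refine ⟨Closed.append c₂ ?_,
      mem_grow_append (o₁.pre.trans o₂.pre) _ _⟩
    rintro m (rfl | rfl)
    · exact hm
    · exact m₂
  cost_le := by have := o₁.cost_le; have := o₂.cost_le; omega
  normal_le := by
    rw [normalVertices_pair (k₁ := v₁) (k₂ := v₂) (by simp),
      o₁.value.normalVertices_eq (o₂.pre.trans (List.prefix_append _ _)),
      o₂.value.normalVertices_eq (List.prefix_append _ _)]
    have := Set.ncard_union_le (normalVertices h₁ v₁ γ₁) (normalVertices h₂ v₂ γ₂)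
    have := o₁.normal_le
    have := o₂.normal_le
    omega

/-- An expression that returns the target of an out-edge of the value of `e`. -/
theorem child {e' : Exp} {nd : Node} (o : Outcome h θ e γ b h₁ v n) (hfv : e'.fv = e.fv)
    (hnd : h₁[v]? = some nd) (hk : k ∈ nd.children)
    (heval : Eval h θ e' h₁ k (1 + n))
    (hunique : ∀ h'' v'' n'', Eval h θ e' h'' v'' n'' → h'' = h₁ ∧ v'' = k ∧ n'' = 1 + n)
    (hv : IsValue h₁ k γ₁) (hs : normalVertices h₁ k γ₁ ⊆ normalVertices h₁ v γ) :
    Outcome h θ e' γ₁ (1 + b) h₁ k (1 + n) where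
  eval := heval
  unique := hunique
  pre := o.pre
  length_le := by have := o.length_le; omega
  value := hv
  closed S hS hθ := by
    obtain ⟨c, m⟩ := o.closed S hS (hfv ▸ hθ)
    refine ⟨c, ?_⟩
    obtain ⟨nd', h₃, h₄⟩ := c v m
    obtain rfl : nd = nd' := by simpa [hnd] using h₃
    exact h₄ hk
  cost_le := by have := o.cost_le; omega
  normal_le := by
    have := Set.ncard_le_ncard hs (normalVertices_finite _ _ _)
    have := o.normal_le
    omega

/-- An expression that returns the value of `e` under a new root vertex. -/
theorem root {e' : Exp} {nd : Node} (o : Outcome h θ e γ b h₁ v n) (hfv : e'.fv = e.fv)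
    (hnd : nd.children = {v})
    (heval : Eval h θ e' (h₁ ++ [nd]) h₁.length (1 + n))
    (hunique : ∀ h'' v'' n'', Eval h θ e' h'' v'' n'' →
      h'' = h₁ ++ [nd] ∧ v'' = h₁.length ∧ n'' = 1 + n)
    (hv : IsValue (h₁ ++ [nd]) h₁.length γ₁)
    (hs : normalVertices (h₁ ++ [nd]) h₁.length γ₁ ⊆
      insert h₁.length (normalVertices h₁ v γ)) :
    Outcome h θ e' γ₁ (1 + b) (h₁ ++ [nd]) h₁.length (1 + n) where
  eval := heval
  unique := hunique
  pre := o.pre.trans (List.prefix_append _ _)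
  length_le := by have := o.length_le; simp; omega
  value := hv
  closed S hS hθ := by
    obtain ⟨c, m⟩ := o.closed S hS (hfv ▸ hθ)
    exact ⟨Closed.append c (by simpa [hnd] using m), mem_grow_append o.pre _ _⟩
  cost_le := by have := o.cost_le; omega
  normal_le := by
    have := Set.ncard_le_ncard hs ((normalVertices_finite _ _ _).insert _)
    have := Set.ncard_insert_le h₁.length (normalVertices h₁ v γ)
    have := o.normal_le
    omega

theorem exists_fst (o : Outcome h θ e (.prod γ₁ γ₂) b h₁ v n) :
    ∃ v₁, Outcome h θ (.fst e) γ₁ (1 + b) h₁ v₁ (1 + n) := by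
  cases o.value with
  | pair hl hv₁ hv₂ =>
    refine ⟨_, o.child (by simp [Exp.fv]) hl (.inl rfl) (.fst o.eval hl) ?_ hv₁ ?_⟩
    · intro h'' v'' n'' H
      cases H with
      | fst H hl' =>
        obtain ⟨rfl, rfl, rfl⟩ := o.unique _ _ _ H
        simp_all
    · rw [normalVertices_pair hl]
      exact Set.subset_union_left

theorem exists_snd (o : Outcome h θ e (.prod γ₁ γ₂) b h₁ v n) :
    ∃ v₂, Outcome h θ (.snd e) γ₂ (1 + b) h₁ v₂ (1 + n) := by
  cases o.value with
  | pair hl hv₁ hv₂ =>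
    refine ⟨_, o.child (by simp [Exp.fv]) hl (.inr rfl) (.snd o.eval hl) ?_ hv₂ ?_⟩
    · intro h'' v'' n'' H
      cases H with
      | snd H hl' =>
        obtain ⟨rfl, rfl, rfl⟩ := o.unique _ _ _ H
        simp_all
    · rw [normalVertices_pair hl]
      exact Set.subset_union_right

theorem inl (o : Outcome h θ e γ₁ b h₁ v n) (γ₂ : Ty) :
    Outcome h θ (.inl e) (.sum γ₁ γ₂) (1 + b) (h₁ ++ [.inl v]) h₁.length (1 + n) := by
  have hl : (h₁ ++ [Node.inl v])[h₁.length]? = some (.inl v) := by simp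
  refine o.root (by simp [Exp.fv]) rfl (.inl o.eval) ?_
    (.inl hl (o.value.mono (List.prefix_append _ _))) ?_
  · intro h'' v'' n'' H
    cases H with
    | inl H =>
      obtain ⟨rfl, rfl, rfl⟩ := o.unique _ _ _ H
      simp
  · rw [normalVertices_inl hl, o.value.normalVertices_eq (List.prefix_append _ _)]
    exact Set.subset_insert _ _

theorem inr (o : Outcome h θ e γ₂ b h₁ v n) (γ₁ : Ty) :
    Outcome h θ (.inr e) (.sum γ₁ γ₂) (1 + b) (h₁ ++ [.inr v]) h₁.length (1 + n) := by
  have hl : (h₁ ++ [Node.inr v])[h₁.length]? = some (.inr v) := by simp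
  refine o.root (by simp [Exp.fv]) rfl (.inr o.eval) ?_
    (.inr hl (o.value.mono (List.prefix_append _ _))) ?_
  · intro h'' v'' n'' H
    cases H with
    | inr H =>
      obtain ⟨rfl, rfl, rfl⟩ := o.unique _ _ _ H
      simp
  · rw [normalVertices_inr hl, o.value.normalVertices_eq (List.prefix_append _ _)]
    exact Set.subset_insert _ _

/-- The new root adds one vertex to the measure. Everything below it was counted already, because
`P(μP)` is a normal type. -/
theorem con {P : Poly} (o : Outcome h θ e (P.app (.mu P)) b h₁ v n) :
    Outcome h θ (.con P e) (.mu P) (1 + b) (h₁ ++ [.con P v]) h₁.length (1 + n) := by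
  have hl : (h₁ ++ [Node.con P v])[h₁.length]? = some (.con P v) := by simp
  have hv : IsNormalValue h₁ v (P.app (.mu P)) := by
    simpa [IsValue, Poly.norm_app_mu] using o.value
  refine o.root (by simp [Exp.fv]) rfl (.con o.eval) ?_
    (.con hl (hv.mono (List.prefix_append _ _))) ?_
  · intro h'' v'' n'' H
    cases H with
    | con H =>
      obtain ⟨rfl, rfl, rfl⟩ := o.unique _ _ _ H
      simp
  · intro m hm
    rcases mem_conVertices_cases hl hm with ⟨rfl, _⟩ | ⟨k, rfl, hk⟩
    · exact .inl rfl
    · rw [hv.conVertices_eq (List.prefix_append _ _)] at hk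
      exact .inr (hv.conVertices_subset hk)

theorem safeCon {P : Poly} (o : Outcome h θ e (P.app (.mu P)).safe b h₁ v n) :
    Outcome h θ (.safeCon P e) (.safeMu P) (1 + b) (h₁ ++ [.con P v]) h₁.length (1 + n) := by
  have hl : (h₁ ++ [Node.con P v])[h₁.length]? = some (.con P v) := by simp
  have hv : IsNormalValue h₁ v (P.app (.mu P)) := by
    simpa [IsValue, Ty.norm_safe, Poly.norm_app_mu] using o.value
  refine o.root (by simp [Exp.fv]) rfl (.safeCon o.eval) ?_
    (.con hl (hv.mono (List.prefix_append _ _))) (Set.empty_subset _)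
  intro h'' v'' n'' H
  cases H with
  | safeCon H =>
    obtain ⟨rfl, rfl, rfl⟩ := o.unique _ _ _ H
    simp

theorem exists_des {P : Poly} (o : Outcome h θ e (.mu P) b h₁ v n) :
    ∃ k, Outcome h θ (.des P e) (P.app (.mu P)) (1 + b) h₁ k (1 + n) := by
  cases o.value with
  | con hl hv =>
    refine ⟨_, o.child (by simp [Exp.fv]) hl rfl (.des o.eval hl) ?_
      (by simpa [IsValue, Poly.norm_app_mu] using hv) ?_⟩
    · intro h'' v'' n'' H
      cases H with
      | des H hl' =>
        obtain ⟨rfl, rfl, rfl⟩ := o.unique _ _ _ H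
        simp_all
    · exact (normalVertices_subset _ _ _).trans (conVertices_subset_of_edge ⟨_, hl, rfl⟩)

theorem exists_safeDes {P : Poly} (o : Outcome h θ e (.safeMu P) b h₁ v n) :
    ∃ k, Outcome h θ (.safeDes P e) (P.app (.mu P)).safe (1 + b) h₁ k (1 + n) := by
  cases o.value with
  | con hl hv =>
    refine ⟨_, o.child (by simp [Exp.fv]) hl rfl (.safeDes o.eval hl) ?_
      (by simpa [IsValue, Ty.norm_safe, Poly.norm_app_mu] using hv) ?_⟩
    · intro h'' v'' n'' H
      cases H with
      | safeDes H hl' =>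
        obtain ⟨rfl, rfl, rfl⟩ := o.unique _ _ _ H
        simp_all
    · rw [normalVertices_safe]
      exact Set.empty_subset _

theorem toSafe (o : Outcome h θ e γ b h₁ v n) :
    Outcome h θ (.toSafe e) γ.safe (1 + b) h₁ v (1 + n) where
  eval := .toSafe o.eval
  unique := by
    intro h'' v'' n'' H
    cases H with
    | toSafe H =>
      obtain ⟨rfl, rfl, rfl⟩ := o.unique _ _ _ H
      simp
  pre := o.pre
  length_le := by have := o.length_le; omega
  value := by simpa [IsValue, Ty.norm_safe] using o.value
  closed := o.closed
  cost_le := by have := o.cost_le; omega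
  normal_le := by simp [normalVertices_safe]

/-- Reachability from `v` stays inside the closed set `grow h h₁ S`; a vertex of its old part `S`
has the same label in both heaps. -/
theorem conVertices_subset (o : Outcome h θ e γ b h₁ v n) {S : Set Loc} (hS : Closed h S)
    (hθ : MapsInto θ e.fv S) :
    conVertices h₁ v ⊆ {m ∈ S | ∃ P k, h[m]? = some (.con P k)} ∪
      Set.Ico h.length h₁.length := by
  obtain ⟨c, hv⟩ := o.closed S hS hθ
  rintro m ⟨hm, P, k, hk⟩
  rcases (c.reach List.prefix_rfl hv hm).1 with hmS | hm'
  · obtain ⟨nd, hnd, _⟩ := hS m hmS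
    obtain rfl : nd = _ := by simpa [getElem?_of_prefix o.pre hnd] using hk
    exact .inl ⟨hmS, P, k, hnd⟩
  · exact .inr hm'

/-- The full value now counts. Its old constructor vertices lie in the graphs of the free variables,
at most `s` for each since their types are normal; its new ones number at most the cost. -/
theorem toNorm {Γ : Ctx} {s : ℕ} (o : Outcome h θ e γ b h₁ v n) (hE : EnvBound Γ θ h s)
    (hfv : ∀ x ∈ e.fv, ∃ α : Ty, Γ x = some α ∧ α.IsNormal) :
    Outcome h θ (.toNorm e) γ.norm (1 + b + e.fv.card * s) h₁ v (1 + n) where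
  eval := .toNorm o.eval
  unique := by
    intro h'' v'' n'' H
    cases H with
    | toNorm H =>
      obtain ⟨rfl, rfl, rfl⟩ := o.unique _ _ _ H
      simp
  pre := o.pre
  length_le := by have := o.length_le; omega
  value := by simpa [IsValue, Ty.norm_norm] using o.value
  closed := o.closed
  cost_le := by have := o.cost_le; omega
  normal_le := by
    have key : ∀ x ∈ e.fv, ∃ l, θ x = some l ∧
        Closed h {m | Relation.ReflTransGen (Edge h) l m} ∧ (conVertices h l).ncard ≤ s := by
      intro x hx
      obtain ⟨α, hα, hn⟩ := hfv x hx
      obtain ⟨l, h₁, h₂, h₃⟩ := hE x α hα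
      rw [IsValue, hn.norm_eq] at h₂
      exact ⟨l, h₁, h₂.closed, (Set.ncard_le_ncard h₂.conVertices_subset
        (normalVertices_finite _ _ _)).trans h₃⟩
    choose! r hr₁ hr₂ hr₃ using key
    -- The smallest possible choice of `S`: what is reachable from the free variables.
    have hS : Closed h {m | ∃ x ∈ e.fv, Relation.ReflTransGen (Edge h) (r x) m} := by
      rintro m ⟨x, hx, hm⟩
      obtain ⟨nd, hnd, hc⟩ := hr₂ x hx m hm
      exact ⟨nd, hnd, fun k hk => ⟨x, hx, hc hk⟩⟩
    have hθ : MapsInto θ e.fv {m | ∃ x ∈ e.fv, Relation.ReflTransGen (Edge h) (r x) m} := by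
      intro x hx l hl
      rw [hr₁ x hx] at hl
      obtain rfl : r x = l := by simpa using hl
      exact ⟨x, hx, .refl⟩
    have hsub : normalVertices h₁ v γ.norm ⊆
        (⋃ x ∈ e.fv, conVertices h (r x)) ∪ Set.Ico h.length h₁.length := by
      refine (normalVertices_subset _ _ _).trans
        ((o.conVertices_subset hS hθ).trans (Set.union_subset_union_left _ ?_))
      rintro m ⟨⟨x, hx, hm⟩, hc⟩
      exact Set.mem_biUnion hx ⟨hm, hc⟩
    have hfin : (⋃ x ∈ e.fv, conVertices h (r x)).Finite :=
      Set.Finite.biUnion e.fv.finite_toSet fun _ _ => conVertices_finite _ _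
    have h₂ := Set.ncard_le_ncard hsub (hfin.union (Set.finite_Ico _ _))
    have h₃ := Set.ncard_union_le (⋃ x ∈ e.fv, conVertices h (r x))
      (Set.Ico h.length h₁.length)
    have h₄ : (⋃ x ∈ e.fv, conVertices h (r x)).ncard ≤ e.fv.card * s :=
      (e.fv.set_ncard_biUnion_le _).trans (Finset.sum_le_card_nsmul _ _ _ hr₃)
    have h₅ : (Set.Ico h.length h₁.length).ncard ≤ n := by
      rw [Set.ncard_eq_toFinset_card']
      have := o.length_le
      simp
      omega
    have := o.cost_le
    omega

-- Case distinction

theorem caseInl {x₁ x₂ : Ident} (o₀ : Outcome h θ e₀ (.sum γ₁ γ₂) b₁ h₁ v₁ n₁)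
    (hl : h₁[v₁]? = some (.inl k))
    (o : Outcome h₁ (Function.update θ x₁ (some k)) e₁ γ b₂ h₂ v n₂) :
    Outcome h θ (.case e₀ x₁ e₁ x₂ e₂) γ (1 + b₁ + b₂) h₂ v (1 + n₁ + n₂) where
  eval := .caseInl o₀.eval hl o.eval
  unique := by
    intro h'' v'' n'' H
    cases H with
    | caseInl H₀ hl' H =>
      obtain ⟨rfl, rfl, rfl⟩ := o₀.unique _ _ _ H₀
      obtain rfl : k = _ := by simpa [hl] using hl'
      obtain ⟨rfl, rfl, rfl⟩ := o.unique _ _ _ H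
      simp
    | caseInr H₀ hl' H =>
      obtain ⟨rfl, rfl, rfl⟩ := o₀.unique _ _ _ H₀
      simp [hl] at hl'
  pre := o₀.pre.trans o.pre
  length_le := by have := o₀.length_le; have := o.length_le; omega
  value := o.value
  closed S hS hθ := by
    obtain ⟨c₁, m₁⟩ := o₀.closed S hS (hθ.mono (by simp [Exp.fv]) subset_rfl)
    obtain ⟨nd, hnd, hc⟩ := c₁ _ m₁
    obtain rfl : _ = nd := by simpa [hl] using hnd
    have := o.closed _ c₁ (MapsInto.update (hθ.mono
      (by simp only [Exp.fv]; exact Finset.subset_union_left.trans Finset.subset_union_right)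
      (subset_grow _ _ _)) (hc rfl))
    rwa [grow_grow o₀.pre o.pre] at this
  cost_le := by have := o₀.cost_le; have := o.cost_le; omega
  normal_le := by have := o.normal_le; omega

theorem caseInr {x₁ x₂ : Ident} (o₀ : Outcome h θ e₀ (.sum γ₁ γ₂) b₁ h₁ v₁ n₁)
    (hl : h₁[v₁]? = some (.inr k))
    (o : Outcome h₁ (Function.update θ x₂ (some k)) e₂ γ b₂ h₂ v n₂) :
    Outcome h θ (.case e₀ x₁ e₁ x₂ e₂) γ (1 + b₁ + b₂) h₂ v (1 + n₁ + n₂) where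
  eval := .caseInr o₀.eval hl o.eval
  unique := by
    intro h'' v'' n'' H
    cases H with
    | caseInr H₀ hl' H =>
      obtain ⟨rfl, rfl, rfl⟩ := o₀.unique _ _ _ H₀
      obtain rfl : k = _ := by simpa [hl] using hl'
      obtain ⟨rfl, rfl, rfl⟩ := o.unique _ _ _ H
      simp
    | caseInl H₀ hl' H =>
      obtain ⟨rfl, rfl, rfl⟩ := o₀.unique _ _ _ H₀
      simp [hl] at hl'
  pre := o₀.pre.trans o.pre
  length_le := by have := o₀.length_le; have := o.length_le; omega
  value := o.value
  closed S hS hθ := by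
    obtain ⟨c₁, m₁⟩ := o₀.closed S hS (hθ.mono (by simp [Exp.fv]) subset_rfl)
    obtain ⟨nd, hnd, hc⟩ := c₁ _ m₁
    obtain rfl : _ = nd := by simpa [hl] using hnd
    have := o.closed _ c₁ (MapsInto.update (hθ.mono
      (by simp only [Exp.fv]; exact Finset.subset_union_right.trans Finset.subset_union_right)
      (subset_grow _ _ _)) (hc rfl))
    rwa [grow_grow o₀.pre o.pre] at this
  cost_le := by have := o₀.cost_le; have := o.cost_le; omega
  normal_le := by have := o.normal_le; omega

end Outcome

/-! ### Structural recursion -/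

/-- The vertices at which the table has an entry. -/
def Memo.dom (M : Memo) : Set Loc := {l | ∃ v, M l = some v}

theorem Memo.dom_update (M : Memo) (l v : Loc) :
    Memo.dom (Function.update M l (some v)) = insert l M.dom := by
  ext m
  by_cases hml : m = l
  · subst hml; simp [Memo.dom]
  · simp [Memo.dom, hml]

/-- The saved results lie in `S`. -/
def Memo.MapsInto (M : Memo) (S : Set Loc) : Prop := ∀ l v, M l = some v → v ∈ S

theorem Memo.MapsInto.update {M : Memo} {S : Set Loc} (hM : M.MapsInto S) {l v : Loc}
    (hv : v ∈ S) : Memo.MapsInto (Function.update M l (some v)) S := by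
  intro m w hw
  by_cases hml : m = l
  · subst hml
    obtain rfl : v = w := by simpa using hw
    exact hv
  · rw [Function.update_of_ne hml] at hw
    exact hM m w hw

/-- The table has finitely many entries, and they are values of type `γ`. -/
def Memo.Valid (M : Memo) (h : Heap) (γ : Ty) : Prop :=
  M.dom.Finite ∧ ∀ l v, M l = some v → IsValue h v γ

theorem Memo.Valid.mono {M : Memo} {h h' : Heap} {γ : Ty} (hM : M.Valid h γ) (hp : h <+: h') :
    M.Valid h' γ := ⟨hM.1, fun l v hv => (hM.2 l v hv).mono hp⟩

theorem Memo.Valid.update {M : Memo} {h : Heap} {γ : Ty} (hM : M.Valid h γ) {l v : Loc}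
    (hv : IsValue h v γ) : Memo.Valid (Function.update M l (some v)) h γ := by
  refine ⟨by rw [Memo.dom_update]; exact hM.1.insert l, fun m w hw => ?_⟩
  by_cases hml : m = l
  · subst hml
    obtain rfl : v = w := by simpa using hw
    exact hv
  · rw [Function.update_of_ne hml] at hw
    exact hM.2 m w hw

/-- `Q(fold_{μP} (λx.e₀))θ` has a unique evaluation at the value at `l` in the heap `h₀` with the
table `M`; each new entry of the table is at a data-type vertex of this value and adds at most
`K` to the cost. -/
structure FoldOutcome (P : Poly) (x : Ident) (e₀ : Exp) (θ : Env) (γ : Ty) (K : ℕ) (h₀ : Heap)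
    (h : Heap) (M : Memo) (Q : Poly) (l : Loc) (h' : Heap) (M' : Memo) (v : Loc) (n : ℕ) :
    Prop where
  eval : FoldMap P x e₀ θ h M Q l h' M' v n
  unique : ∀ h'' M'' v'' n'', FoldMap P x e₀ θ h M Q l h'' M'' v'' n'' →
    h'' = h' ∧ M'' = M' ∧ v'' = v ∧ n'' = n
  pre : h <+: h'
  length_le : h'.length ≤ h.length + n
  value : IsValue h' v (Q.app γ.safe)
  -- The normal constituents of `Q(Sγ)` come from the constants of `Q`, which are passed on from the
  -- argument unchanged.
  normal_subset : normalVertices h' v (Q.app γ.safe) ⊆ conVertices h₀ l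
  valid : M'.Valid h' γ.safe
  subset_dom : M'.dom ⊆ M.dom ∪ conVertices h₀ l
  -- An amortised bound: `K` pays for each new entry and `Q.nodes` for traversing `Q`, with a lookup
  -- charged to its occurrence of `Id`. The table terms telescope along a product.
  cost_le : n + K * M.dom.ncard ≤ Q.nodes + K * M'.dom.ncard
  closed : ∀ S, Closed h S → MapsInto θ (e₀.fv.erase x) S → M.MapsInto S → l ∈ S →
    Closed h' (grow h h' S) ∧ M'.MapsInto (grow h h' S) ∧ v ∈ grow h h' S

namespace FoldOutcome

variable {P Q R : Poly} {x : Ident} {e₀ : Exp} {θ : Env} {γ : Ty} {K b : ℕ}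
  {h₀ h h₁ h₂ : Heap} {M M₁ M₂ : Memo} {l k k₁ k₂ u v v₁ v₂ : Loc} {n n₁ n₂ : ℕ}

theorem lookup (hM : M.Valid h γ.safe) (hl : M l = some v) :
    FoldOutcome P x e₀ θ γ K h₀ h M .id l h M v 1 where
  eval := .lookup hl
  unique := by
    intro h'' M'' v'' n'' H
    cases H <;> simp_all
  pre := List.prefix_rfl
  length_le := by simp
  value := hM.2 l v hl
  normal_subset := by simp [Poly.app, normalVertices_safe]
  valid := hM
  subset_dom := Set.subset_union_left
  cost_le := by simp [Poly.nodes]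
  closed S hS _ hMS _ := by
    rw [grow_self]
    exact ⟨hS, hMS, hMS l v hl⟩

/-- The new entry at `l` releases a budget `K`, which covers traversing `P` and one call of the step
function. The remaining node is paid by `Id`. -/
theorem step (hv : IsNormalValue h₀ l (.mu P)) (hp : h₀ <+: h) (hl : h₀[l]? = some (.con P k))
    (hM : M l = none) (o : FoldOutcome P x e₀ θ γ K h₀ h M P k h₁ M₁ u n₁)
    (o' : Outcome h₁ (Function.update θ x (some u)) e₀ γ.safe b h₂ v n)
    (hK : P.nodes + b ≤ K) :
    FoldOutcome P x e₀ θ γ K h₀ h M .id l h₂ (Function.update M₁ l (some v)) v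
      (1 + n₁ + n) where
  eval := .step hM (getElem?_of_prefix hp hl) o.eval o'.eval
  unique := by
    intro h'' M'' v'' n'' H
    cases H with
    | lookup hl' => simp [hM] at hl'
    | step _ hl' H H' =>
      rw [getElem?_of_prefix hp hl] at hl'
      obtain rfl : k = _ := by simpa using hl'
      obtain ⟨rfl, rfl, rfl, rfl⟩ := o.unique _ _ _ _ H
      obtain ⟨rfl, rfl, rfl⟩ := o'.unique _ _ _ H'
      simp
  pre := o.pre.trans o'.pre
  length_le := by have := o.length_le; have := o'.length_le; omega
  value := o'.value
  normal_subset := by simp [Poly.app, normalVertices_safe]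
  valid := (o.valid.mono o'.pre).update o'.value
  subset_dom := by
    rw [Memo.dom_update]
    rintro m (rfl | hm)
    · exact .inr ⟨.refl, P, k, hl⟩
    · exact Set.union_subset_union_right _ (conVertices_subset_of_edge ⟨_, hl, rfl⟩)
        (o.subset_dom hm)
  cost_le := by
    -- The entry is really new: it was absent before, and the entries added meanwhile lie below `k`,
    -- from which `l` is unreachable by acyclicity.
    have hl' : l ∉ M₁.dom := by
      intro hmem
      rcases o.subset_dom hmem with ⟨w, hw⟩ | ⟨hr, _⟩
      · simp [hM] at hw
      · exact hv.not_reach_of_edge ⟨_, hl, rfl⟩ hr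
    rw [Memo.dom_update, Set.ncard_insert_of_notMem hl' o.valid.1, Nat.mul_succ]
    have := o.cost_le
    have := o'.cost_le
    simp only [Poly.nodes]
    omega
  closed S hS hθ hMS hlS := by
    obtain ⟨nd, hnd, hc⟩ := hS l hlS
    rw [getElem?_of_prefix hp hl] at hnd
    obtain rfl : _ = nd := by simpa using hnd
    obtain ⟨c₁, m₁, u₁⟩ := o.closed S hS hθ hMS (hc rfl)
    have := o'.closed _ c₁ (MapsInto.update (hθ.mono subset_rfl (subset_grow _ _ _)) u₁)
    have hm := fun a w hw => subset_grow h₁ h₂ _ (m₁ a w hw)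
    rw [grow_grow o.pre o'.pre] at this hm
    exact ⟨this.1, Memo.MapsInto.update hm this.2, this.2⟩

theorem const (hM : M.Valid h γ.safe) (hp : h₀ <+: h) (hQ : Q.nodes = 1)
    (heval : FoldMap P x e₀ θ h M Q l h M l 1)
    (hunique : ∀ h'' M'' v'' n'', FoldMap P x e₀ θ h M Q l h'' M'' v'' n'' →
      h'' = h ∧ M'' = M ∧ v'' = l ∧ n'' = 1)
    (hv : IsValue h₀ l (Q.app γ.safe)) :
    FoldOutcome P x e₀ θ γ K h₀ h M Q l h M l 1 where
  eval := heval
  unique := hunique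
  pre := List.prefix_rfl
  length_le := by simp
  value := hv.mono hp
  normal_subset := by
    rw [hv.normalVertices_eq hp]
    exact normalVertices_subset _ _ _
  valid := hM
  subset_dom := Set.subset_union_left
  cost_le := by simp [hQ]
  closed S hS _ hMS hlS := by
    rw [grow_self]
    exact ⟨hS, hMS, hlS⟩

theorem sumInl (hp : h₀ <+: h) (hl : h₀[l]? = some (.inl k))
    (o : FoldOutcome P x e₀ θ γ K h₀ h M Q k h₁ M₁ v n) :
    FoldOutcome P x e₀ θ γ K h₀ h M (.sum Q R) l (h₁ ++ [.inl v]) M₁ h₁.length (1 + n) where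
  eval := .sumInl (getElem?_of_prefix hp hl) o.eval
  unique := by
    intro h'' M'' v'' n'' H
    have hl' := getElem?_of_prefix hp hl
    cases H with
    | sumInl hl'' H =>
      rw [hl'] at hl''
      obtain rfl : k = _ := by simpa using hl''
      obtain ⟨rfl, rfl, rfl, rfl⟩ := o.unique _ _ _ _ H
      simp
    | sumInr hl'' H => simp [hl'] at hl''
  pre := o.pre.trans (List.prefix_append _ _)
  length_le := by have := o.length_le; simp; omega
  value := .inl (by simp) (o.value.mono (List.prefix_append _ _))
  normal_subset := by
    rw [Poly.app, normalVertices_inl (k := v) (by simp),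
      o.value.normalVertices_eq (List.prefix_append _ _)]
    exact o.normal_subset.trans (conVertices_subset_of_edge ⟨_, hl, rfl⟩)
  valid := o.valid.mono (List.prefix_append _ _)
  subset_dom := o.subset_dom.trans
    (Set.union_subset_union_right _ (conVertices_subset_of_edge ⟨_, hl, rfl⟩))
  cost_le := by have := o.cost_le; simp only [Poly.nodes]; omega
  closed S hS hθ hMS hlS := by
    obtain ⟨nd, hnd, hc⟩ := hS l hlS
    rw [getElem?_of_prefix hp hl] at hnd
    obtain rfl : _ = nd := by simpa using hnd
    obtain ⟨c₁, m₁, u₁⟩ := o.closed S hS hθ hMS (hc rfl)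
    exact ⟨Closed.append c₁ (by simpa [Node.children] using u₁),
      fun a w hw => grow_subset_append _ _ _ _ (m₁ a w hw), mem_grow_append o.pre _ _⟩

theorem sumInr (hp : h₀ <+: h) (hl : h₀[l]? = some (.inr k))
    (o : FoldOutcome P x e₀ θ γ K h₀ h M R k h₁ M₁ v n) :
    FoldOutcome P x e₀ θ γ K h₀ h M (.sum Q R) l (h₁ ++ [.inr v]) M₁ h₁.length (1 + n) where
  eval := .sumInr (getElem?_of_prefix hp hl) o.eval
  unique := by
    intro h'' M'' v'' n'' H
    have hl' := getElem?_of_prefix hp hl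
    cases H with
    | sumInr hl'' H =>
      rw [hl'] at hl''
      obtain rfl : k = _ := by simpa using hl''
      obtain ⟨rfl, rfl, rfl, rfl⟩ := o.unique _ _ _ _ H
      simp
    | sumInl hl'' H => simp [hl'] at hl''
  pre := o.pre.trans (List.prefix_append _ _)
  length_le := by have := o.length_le; simp; omega
  value := .inr (by simp) (o.value.mono (List.prefix_append _ _))
  normal_subset := by
    rw [Poly.app, normalVertices_inr (k := v) (by simp),
      o.value.normalVertices_eq (List.prefix_append _ _)]
    exact o.normal_subset.trans (conVertices_subset_of_edge ⟨_, hl, rfl⟩)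
  valid := o.valid.mono (List.prefix_append _ _)
  subset_dom := o.subset_dom.trans
    (Set.union_subset_union_right _ (conVertices_subset_of_edge ⟨_, hl, rfl⟩))
  cost_le := by have := o.cost_le; simp only [Poly.nodes]; omega
  closed S hS hθ hMS hlS := by
    obtain ⟨nd, hnd, hc⟩ := hS l hlS
    rw [getElem?_of_prefix hp hl] at hnd
    obtain rfl : _ = nd := by simpa using hnd
    obtain ⟨c₁, m₁, u₁⟩ := o.closed S hS hθ hMS (hc rfl)
    exact ⟨Closed.append c₁ (by simpa [Node.children] using u₁),
      fun a w hw => grow_subset_append _ _ _ _ (m₁ a w hw), mem_grow_append o.pre _ _⟩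

theorem prod (hp : h₀ <+: h) (hl : h₀[l]? = some (.pair k₁ k₂))
    (o₁ : FoldOutcome P x e₀ θ γ K h₀ h M Q k₁ h₁ M₁ v₁ n₁)
    (o₂ : FoldOutcome P x e₀ θ γ K h₀ h₁ M₁ R k₂ h₂ M₂ v₂ n₂) :
    FoldOutcome P x e₀ θ γ K h₀ h M (.prod Q R) l (h₂ ++ [.pair v₁ v₂]) M₂ h₂.length
      (1 + n₁ + n₂) where
  eval := .prod (getElem?_of_prefix hp hl) o₁.eval o₂.eval
  unique := by
    intro h'' M'' v'' n'' H
    have hl' := getElem?_of_prefix hp hl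
    cases H with
    | prod hl'' H₁ H₂ =>
      rw [hl'] at hl''
      obtain ⟨rfl, rfl⟩ : k₁ = _ ∧ k₂ = _ := by simpa using hl''
      obtain ⟨rfl, rfl, rfl, rfl⟩ := o₁.unique _ _ _ _ H₁
      obtain ⟨rfl, rfl, rfl, rfl⟩ := o₂.unique _ _ _ _ H₂
      simp
  pre := (o₁.pre.trans o₂.pre).trans (List.prefix_append _ _)
  length_le := by have := o₁.length_le; have := o₂.length_le; simp; omega
  value := .pair (by simp) (o₁.value.mono (o₂.pre.trans (List.prefix_append _ _)))
    (o₂.value.mono (List.prefix_append _ _))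
  normal_subset := by
    rw [Poly.app, normalVertices_pair (k₁ := v₁) (k₂ := v₂) (by simp),
      o₁.value.normalVertices_eq (o₂.pre.trans (List.prefix_append _ _)),
      o₂.value.normalVertices_eq (List.prefix_append _ _)]
    exact Set.union_subset
      (o₁.normal_subset.trans (conVertices_subset_of_edge ⟨_, hl, .inl rfl⟩))
      (o₂.normal_subset.trans (conVertices_subset_of_edge ⟨_, hl, .inr rfl⟩))
  valid := o₂.valid.mono (List.prefix_append _ _)
  subset_dom := by
    intro m hm
    rcases o₂.subset_dom hm with hm | hm
    · exact Set.union_subset_union_right _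
        (conVertices_subset_of_edge ⟨_, hl, .inl rfl⟩) (o₁.subset_dom hm)
    · exact .inr (conVertices_subset_of_edge ⟨_, hl, .inr rfl⟩ hm)
  cost_le := by
    have := o₁.cost_le
    have := o₂.cost_le
    simp only [Poly.nodes]
    omega
  closed S hS hθ hMS hlS := by
    obtain ⟨nd, hnd, hc⟩ := hS l hlS
    rw [getElem?_of_prefix hp hl] at hnd
    obtain rfl : _ = nd := by simpa using hnd
    obtain ⟨c₁, m₁, u₁⟩ := o₁.closed S hS hθ hMS (hc (.inl rfl))
    obtain ⟨c₂, m₂, u₂⟩ := o₂.closed _ c₁ (hθ.mono subset_rfl (subset_grow _ _ _)) m₁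
      (subset_grow _ _ _ (hc (.inr rfl)))
    have hm := subset_grow h₁ h₂ _ u₁
    rw [grow_grow o₁.pre o₂.pre] at c₂ m₂ u₂ hm
    refine ⟨Closed.append c₂ ?_, fun a w hw => grow_subset_append _ _ _ _ (m₂ a w hw),
      mem_grow_append (o₁.pre.trans o₂.pre) _ _⟩
    rintro m (rfl | rfl)
    · exact hm
    · exact u₂

end FoldOutcome

/-- Induction on the typing derivation of the argument, for all `Q`, heaps and tables
simultaneously. The argument is always read in the initial heap `h₀`. The bound `b` in `hb` is
uniform because `s` limits the normal part of every input to the step function. -/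
theorem exists_foldOutcome {P : Poly} {x : Ident} {e₀ : Exp} {θ : Env} {γ : Ty}
    {s b : ℕ} {h₀ : Heap}
    (hb : ∀ h u, h₀ <+: h → IsValue h u (P.app γ.safe) →
      (normalVertices h u (P.app γ.safe)).ncard ≤ s →
      ∃ h' v n, Outcome h (Function.update θ x (some u)) e₀ γ.safe b h' v n)
    {l : Loc} {α : Ty} (hv : IsNormalValue h₀ l α) (hs : (conVertices h₀ l).ncard ≤ s)
    (Q : Poly) (hα : α = Q.app (.mu P)) (h : Heap) (hp : h₀ <+: h) (M : Memo)
    (hM : M.Valid h γ.safe) :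
    ∃ h' M' v n, FoldOutcome P x e₀ θ γ (P.nodes + b) h₀ h M Q l h' M' v n := by
  have hunit : ∀ l, IsNormalValue h₀ l .unit → ∀ h, h₀ <+: h → ∀ M : Memo, M.Valid h γ.safe →
      FoldOutcome P x e₀ θ γ (P.nodes + b) h₀ h M .constUnit l h M l 1 := by
    intro l hv h hp M hM
    refine .const hM hp rfl .constUnit ?_ hv
    intro _ _ _ _ H
    cases H
    simp
  have hmu : ∀ R l, IsNormalValue h₀ l (.mu R) → ∀ h, h₀ <+: h → ∀ M : Memo,
      M.Valid h γ.safe →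
      FoldOutcome P x e₀ θ γ (P.nodes + b) h₀ h M (.constMu R) l h M l 1 := by
    intro R l hv h hp M hM
    refine .const hM hp rfl .constMu ?_ hv
    intro _ _ _ _ H
    cases H
    simp
  have hchild : ∀ {l k : Loc}, Edge h₀ l k → (conVertices h₀ l).ncard ≤ s →
      (conVertices h₀ k).ncard ≤ s := fun he hs =>
    (Set.ncard_le_ncard (conVertices_subset_of_edge he) (conVertices_finite _ _)).trans hs
  induction hv generalizing Q h M with
  | unit hl =>
    -- The equation `α = Q(μP)` determines `Q` up to its subfunctors, except at a constructor
    -- vertex, where `Q` may be `Id` or a constant.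
    cases Q <;> simp only [Poly.app, reduceCtorEq] at hα
    exact ⟨_, _, _, _, hunit _ (.unit hl) h hp M hM⟩
  | inl hl _ ih =>
    cases Q <;> simp only [Poly.app, reduceCtorEq, Ty.sum.injEq] at hα
    obtain ⟨_, _, _, _, o⟩ := ih (hchild ⟨_, hl, rfl⟩ hs) _ hα.1 h hp M hM
    exact ⟨_, _, _, _, o.sumInl hp hl⟩
  | inr hl _ ih =>
    cases Q <;> simp only [Poly.app, reduceCtorEq, Ty.sum.injEq] at hα
    obtain ⟨_, _, _, _, o⟩ := ih (hchild ⟨_, hl, rfl⟩ hs) _ hα.2 h hp M hM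
    exact ⟨_, _, _, _, o.sumInr hp hl⟩
  | pair hl _ _ ih₁ ih₂ =>
    cases Q <;> simp only [Poly.app, reduceCtorEq, Ty.prod.injEq] at hα
    obtain ⟨_, _, _, _, o₁⟩ := ih₁ (hchild ⟨_, hl, .inl rfl⟩ hs) _ hα.1 h hp M hM
    obtain ⟨_, _, _, _, o₂⟩ := ih₂ (hchild ⟨_, hl, .inr rfl⟩ hs) _ hα.2 _ (hp.trans o₁.pre) _
      o₁.valid
    exact ⟨_, _, _, _, o₁.prod hp hl o₂⟩
  | @con l k P' hl hk ih =>
    cases Q <;> simp only [Poly.app, reduceCtorEq, Ty.mu.injEq] at hα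
    · subst hα
      cases hMl : M l with
      | some v => exact ⟨_, _, _, _, .lookup hM hMl⟩
      | none =>
        have hs' := hchild ⟨_, hl, rfl⟩ hs
        obtain ⟨_, _, u, _, o⟩ := ih hs' P' rfl h hp M hM
        obtain ⟨_, _, _, o'⟩ := hb _ u (hp.trans o.pre) o.value
          ((Set.ncard_le_ncard o.normal_subset (conVertices_finite _ _)).trans hs')
        exact ⟨_, _, _, _, o.step (.con hl hk) hp hl hMl o' le_rfl⟩
    · subst hα
      exact ⟨_, _, _, _, hmu _ _ (.con hl hk) h hp M hM⟩

/-- From an empty table, at most `b` entries are made, at constructor vertices of the normal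
argument. The `2` pays for the node of the recursion itself and for `Id.nodes`. -/
theorem Outcome.fold {h h₁ h₂ : Heap} {θ : Env} {P : Poly} {x : Ident} {e₀ e₁ : Exp} {γ : Ty}
    {v₁ v : Loc} {b K n₁ n : ℕ} {M : Memo} (o₁ : Outcome h θ e₁ (.mu P) b h₁ v₁ n₁)
    (o : FoldOutcome P x e₀ θ γ K h₁ h₁ (fun _ => none) .id v₁ h₂ M v n) :
    Outcome h θ (.fold P (.lam x e₀) e₁) γ.safe (2 + b + K * b) h₂ v (1 + n₁ + n) where
  eval := .fold o₁.eval o.eval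
  unique := by
    intro h'' v'' n'' H
    cases H with
    | fold H₁ H =>
      obtain ⟨rfl, rfl, rfl⟩ := o₁.unique _ _ _ H₁
      obtain ⟨rfl, rfl, rfl, rfl⟩ := o.unique _ _ _ _ H
      simp
  pre := o₁.pre.trans o.pre
  length_le := by have := o₁.length_le; have := o.length_le; omega
  value := o.value
  closed S hS hθ := by
    obtain ⟨c₁, m₁⟩ := o₁.closed S hS (hθ.mono (by simp [Exp.fv]) subset_rfl)
    have := o.closed _ c₁ (hθ.mono (by simp [Exp.fv]) (subset_grow _ _ _))
      (by simp [Memo.MapsInto]) m₁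
    rw [grow_grow o₁.pre o.pre] at this
    exact ⟨this.1, this.2.2⟩
  cost_le := by
    have hdom : M.dom.ncard ≤ b := by
      refine (Set.ncard_le_ncard (o.subset_dom.trans ?_) (conVertices_finite h₁ v₁)).trans
        o₁.normal_le
      simp [Memo.dom]
    have h₃ := o.cost_le
    have h₄ := o₁.cost_le
    have h₅ := Nat.mul_le_mul_left K hdom
    have h₆ : (Memo.dom fun _ => none).ncard = 0 := by simp [Memo.dom]
    rw [h₆] at h₃
    simp only [Poly.nodes] at h₃
    omega
  normal_le := by simp [normalVertices_safe]

/-! ### Soundness -/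

/-- The property of typable expressions by which soundness is proved: an expression of ground type
is polynomially bounded, and an expression of level-1 type is an abstraction with a polynomially
bounded body. -/
def Sound (Γ : Ctx) (e : Exp) : FTy → Prop
  | .ground γ => PolyBounded Γ e γ
  | .arrow γ₁ γ₀ => ∃ x e₀, e = .lam x e₀ ∧ PolyBounded (Function.update Γ x (some γ₁)) e₀ γ₀

open Polynomial in
-- Every binding follows one pattern: the body runs in an environment of measure at most `s +
-- q₁(s)`, where `q₁` bounds the bound value. This is the source of each `comp (X + _)`.
theorem HasType.sound {Γ : Ctx} {e : Exp} {τ : FTy} (ht : HasType Γ e τ) : Sound Γ e τ := by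
  induction ht with
  | var hx _ =>
    refine ⟨X + 1, fun h θ s hE => ?_⟩
    obtain ⟨l, h₁, h₂, h₃⟩ := hE _ _ hx
    exact ⟨_, _, _, (Outcome.var h₁ h₂ h₃).mono (by simp)⟩
  | lam _ _ ih => exact ⟨_, _, rfl, ih⟩
  | app _ _ ih₀ ih₁ =>
    obtain ⟨x, e₀, rfl, q₀, hq₀⟩ := ih₀
    obtain ⟨q₁, hq₁⟩ := ih₁
    refine ⟨1 + q₁ + q₀.comp (X + q₁), fun h θ s hE => ?_⟩
    obtain ⟨h₁, v₁, n₁, o₁⟩ := hq₁ h θ s hE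
    obtain ⟨_, _, _, o₀⟩ := hq₀ h₁ _ (s + q₁.eval s)
      ((hE.mono o₁.pre (Nat.le_add_right _ _)).update o₁.value
        (o₁.normal_le.trans (Nat.le_add_left _ _)) x)
    exact ⟨_, _, _, (o₁.app o₀).mono (by simp)⟩
  | unit => exact ⟨1, fun h θ s _ => ⟨_, _, _, Outcome.unit.mono (by simp)⟩⟩
  | pair _ _ ih₁ ih₂ =>
    obtain ⟨q₁, hq₁⟩ := ih₁
    obtain ⟨q₂, hq₂⟩ := ih₂
    refine ⟨1 + q₁ + q₂, fun h θ s hE => ?_⟩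
    obtain ⟨_, _, _, o₁⟩ := hq₁ h θ s hE
    obtain ⟨_, _, _, o₂⟩ := hq₂ _ θ s (hE.mono o₁.pre le_rfl)
    exact ⟨_, _, _, (o₁.pair o₂).mono (by simp)⟩
  | fst _ ih =>
    obtain ⟨q, hq⟩ := ih
    refine ⟨1 + q, fun h θ s hE => ?_⟩
    obtain ⟨_, _, _, o⟩ := hq h θ s hE
    obtain ⟨_, o'⟩ := o.exists_fst
    exact ⟨_, _, _, o'.mono (by simp)⟩
  | snd _ ih =>
    obtain ⟨q, hq⟩ := ih
    refine ⟨1 + q, fun h θ s hE => ?_⟩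
    obtain ⟨_, _, _, o⟩ := hq h θ s hE
    obtain ⟨_, o'⟩ := o.exists_snd
    exact ⟨_, _, _, o'.mono (by simp)⟩
  | inl _ _ ih =>
    obtain ⟨q, hq⟩ := ih
    refine ⟨1 + q, fun h θ s hE => ?_⟩
    obtain ⟨_, _, _, o⟩ := hq h θ s hE
    exact ⟨_, _, _, (o.inl _).mono (by simp)⟩
  | inr _ _ ih =>
    obtain ⟨q, hq⟩ := ih
    refine ⟨1 + q, fun h θ s hE => ?_⟩
    obtain ⟨_, _, _, o⟩ := hq h θ s hE
    exact ⟨_, _, _, (o.inr _).mono (by simp)⟩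
  | case _ _ _ _ ih₀ ih₁ ih₂ =>
    obtain ⟨q₀, hq₀⟩ := ih₀
    obtain ⟨q₁, hq₁⟩ := ih₁
    obtain ⟨q₂, hq₂⟩ := ih₂
    -- The sum of both branch bounds dominates whichever branch is taken.
    refine ⟨1 + q₀ + (q₁.comp (X + q₀) + q₂.comp (X + q₀)), fun h θ s hE => ?_⟩
    obtain ⟨h₁, v₀, n₀, o₀⟩ := hq₀ h θ s hE
    have hE' := hE.mono o₀.pre (Nat.le_add_right s (q₀.eval s))
    have hs := o₀.normal_le.trans (Nat.le_add_left (q₀.eval s) s)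
    cases o₀.value with
    | inl hl hk =>
      rw [normalVertices_inl hl] at hs
      obtain ⟨_, _, _, o⟩ := hq₁ h₁ _ _ (hE'.update hk hs _)
      exact ⟨_, _, _, (o₀.caseInl hl o).mono (by simp)⟩
    | inr hl hk =>
      rw [normalVertices_inr hl] at hs
      obtain ⟨_, _, _, o⟩ := hq₂ h₁ _ _ (hE'.update hk hs _)
      exact ⟨_, _, _, (o₀.caseInr hl o).mono (by simp)⟩
  | con _ _ ih =>
    obtain ⟨q, hq⟩ := ih
    refine ⟨1 + q, fun h θ s hE => ?_⟩
    obtain ⟨_, _, _, o⟩ := hq h θ s hE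
    exact ⟨_, _, _, o.con.mono (by simp)⟩
  | des _ ih =>
    obtain ⟨q, hq⟩ := ih
    refine ⟨1 + q, fun h θ s hE => ?_⟩
    obtain ⟨_, _, _, o⟩ := hq h θ s hE
    obtain ⟨_, o'⟩ := o.exists_des
    exact ⟨_, _, _, o'.mono (by simp)⟩
  | @fold Γ P x e₀ e₁ γ _ _ ih₀ ih₁ =>
    obtain ⟨x', e', he, q₀, hq₀⟩ := ih₀
    obtain ⟨rfl, rfl⟩ : x = x' ∧ e₀ = e' := by simpa using he
    obtain ⟨q₁, hq₁⟩ := ih₁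
    -- The factor in parentheses is the charge per table entry; the last `q₁` bounds the number of
    -- entries.
    refine ⟨2 + q₁ + (P.nodes + q₀.comp (X + q₁)) * q₁, fun h θ s hE => ?_⟩
    obtain ⟨h₁, v₁, n₁, o₁⟩ := hq₁ h θ s hE
    obtain ⟨_, _, _, _, o⟩ := exists_foldOutcome (P := P) (x := x) (e₀ := e₀) (θ := θ) (γ := γ)
      (s := s + q₁.eval s) (b := q₀.eval (s + q₁.eval s)) (h₀ := h₁)
      (fun h' u hp hu hs => hq₀ h' _ _
        ((hE.mono (o₁.pre.trans hp) (Nat.le_add_right _ _)).update hu hs x))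
      o₁.value (o₁.normal_le.trans (Nat.le_add_left _ _)) .id rfl h₁ List.prefix_rfl
      (fun _ => none) ⟨by simp [Memo.dom], by simp⟩
    exact ⟨_, _, _, (o₁.fold o).mono (by simp)⟩
  | safeCon _ _ ih =>
    obtain ⟨q, hq⟩ := ih
    refine ⟨1 + q, fun h θ s hE => ?_⟩
    obtain ⟨_, _, _, o⟩ := hq h θ s hE
    exact ⟨_, _, _, o.safeCon.mono (by simp)⟩
  | safeDes _ ih =>
    obtain ⟨q, hq⟩ := ih
    refine ⟨1 + q, fun h θ s hE => ?_⟩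
    obtain ⟨_, _, _, o⟩ := hq h θ s hE
    obtain ⟨_, o'⟩ := o.exists_safeDes
    exact ⟨_, _, _, o'.mono (by simp)⟩
  | toSafe _ ih =>
    obtain ⟨q, hq⟩ := ih
    refine ⟨1 + q, fun h θ s hE => ?_⟩
    obtain ⟨_, _, _, o⟩ := hq h θ s hE
    exact ⟨_, _, _, o.toSafe.mono (by simp)⟩
  | @toNorm Γ e γ hfv _ ih =>
    obtain ⟨q, hq⟩ := ih
    refine ⟨1 + q + (e.fv.card : ℕ[X]) * X, fun h θ s hE => ?_⟩
    obtain ⟨_, _, _, o⟩ := hq h θ s hE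
    exact ⟨_, _, _, (o.toNorm hE hfv).mono (by simp)⟩

end RSMinus

open RSMinus in
theorem theoremt (f : RSMinus.Exp) (γ₁ γ₀ : RSMinus.Ty)
    (hf : RSMinus.HasType (fun _ => none) f (RSMinus.FTy.arrow γ₁ γ₀)) (hγ₁ : γ₁.IsNormal) :
    RSMinus.DPPolyCost f γ₁ := by
  obtain ⟨y, e₀, rfl, q, hq⟩ := hf.sound
  -- One node for the application and one for its argument `x`; `q` bounds the body.
  refine ⟨2 + q, fun x h l hl => ?_⟩
  have hE : EnvBound (fun _ => none) (Env.single x l) h (size h l) := by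
    intro _ _ hy
    simp at hy
  have hs : (normalVertices h l γ₁).ncard ≤ size h l :=
    Set.ncard_le_ncard (normalVertices_subset h l γ₁) (conVertices_finite h l)
  have oarg : Outcome h (Env.single x l) (.var x) γ₁ (size h l + 1) h l 1 :=
    .var (by simp [Env.single]) hl hs
  obtain ⟨h', v, n, o⟩ := hq h _ _ (hE.update hl hs y)
  have oapp := oarg.app o
  refine ⟨⟨_, _, _, oapp.eval⟩, fun h'' v'' n'' H => ?_⟩
  obtain ⟨_, _, rfl⟩ := oapp.unique _ _ _ H
  have := o.cost_le
  simp
  omega
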